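/- Let $V$ be a finite non-empty set with $n$ elements and let $r\in V$. Consider the complete graph with self-loops on $V$, so that simple random walk moves at each step to a uniformly chosen element of $V$ (possibly the current vertex). **Aldous–Broder.** Let $(X_t)_{t\ge 0}$ be the simple random walk started at $X_0=r$, let $V_t=\{X_0,\dots,X_t\}$, and let $\eta=\inf\{t: V_t=V\}$ be the cover time. Put $\sigma^{\rm in}_0=0$ and, for $i\ge 1$, $$\sigma^{\rm out}_i=\inf\{t>\sigma^{\rm in}_{i-1}: X_t\notin V_{t-1}\}\wedge\eta,\qquad \sigma^{\rm in}_i=\inf\{t>\sigma^{\rm out}_i: X_t\in V_{t-1}\}\wedge\eta .$$ Let $\mathcal T^{AB}_t$ be the graph with vertex set $V_t$ and edge set $\{\{X_k,X_{k+1}\}: k<t,\ X_{k+1}\notin V_k\}$. **Wilson.** Start with the tree $(\{r\},\varnothing)$. As long as the current tree $(V',E')$ does not span $V$: choose $v\in V\setminus V'$ uniformly at random, run a simple random walk from $v$, independent of the past, until it first visits $V'$, and then add to the tree the vertices and edges of the chronological loop erasure of this walk (a branch). Time advances by one with each choice of a starting vertex and with each step of a walk; let $\mathcal T^{W}_t$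 be the tree built by time $t$. Let $\hat\sigma_0=0$ and, for $i\ge1$, let $\hat\sigma_i$ be the time at which the $i$-th branch is added to the tree, or the time at which the tree becomes spanning if there are fewer than $i$ branches. **Theorem.** For every $i\ge 0$, $\hat\sigma_i$ and $\sigma^{\rm in}_i$ are almost surely finite stopping times with respect to the filtrations generated by the run of Wilson's algorithm and by $(X_t)$, respectively, and $$\mathcal T^{W}_{\hat\sigma_i}\ \overset{d}{=}\ \mathcal T^{AB}_{\sigma^{\rm in}_i}$$ as random labelled trees, that is, as random pairs (vertex set, edge set). -/

import Mathlib

open MeasureTheory ProbabilityTheory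

noncomputable section

/-- An undirected graph on `V` without multiple edges, in which self-loops are allowed. -/
structure LoopGraph (V : Type*) where
  Adj : V → V → Prop
  symm : ∀ u v, Adj u v → Adj v u

/-- The complete graph with self-loops: any two vertices, distinct or not, are adjacent. -/
def LoopGraph.complete (V : Type*) : LoopGraph V where
  Adj _ _ := True
  symm _ _ _ := trivial

open Classical in
/-- The neighbours of `v`; `v` is among them iff there is a self-loop at `v`. -/
def LoopGraph.nbrs {V : Type*} [Fintype V] (G : LoopGraph V) (v : V) : Finset V :=
  Finset.univ.filter (G.Adj v)

open Classical in
/-- One step of simple random walk from `v`: a uniformly chosen neighbour of `v`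
(the walk stays put at a vertex without neighbours). -/
def LoopGraph.step {V : Type*} [Fintype V] (G : LoopGraph V) (v : V) : PMF V :=
  if h : (G.nbrs v).Nonempty then PMF.uniformOfFinset (G.nbrs v) h else PMF.pure v

/-- `X` is, under `P`, a time-homogeneous Markov chain with transition probabilities `K`,
started at `s₀`. The state space carries its discrete σ-algebra. -/
structure IsMarkovChain {Ω S : Type*} [MeasurableSpace Ω] [DecidableEq S] (P : Measure Ω)
    (K : S → PMF S) (s₀ : S) (X : ℕ → Ω → S) : Prop where
  measurable : ∀ t, Measurable[_, ⊤] (X t)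
  path_law : ∀ (n : ℕ) (x : ℕ → S), P {ω | ∀ k ≤ n, X k ω = x k} =
    (if x 0 = s₀ then 1 else 0) * ∏ k ∈ Finset.range n, K (x k) (x (k + 1))

/-- The filtration generated by a process with values in a discrete space. -/
def pastFiltration {Ω S : Type*} [m : MeasurableSpace Ω] (X : ℕ → Ω → S)
    (hX : ∀ t, Measurable[m, ⊤] (X t)) : Filtration ℕ m where
  seq t := ⨆ k ≤ t, MeasurableSpace.comap (X k) ⊤
  mono' _ _ h := iSup₂_mono' fun k hk => ⟨k, hk.trans h, le_rfl⟩
  le' _ := iSup₂_le fun k _ => (hX k).comap_le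

/-- `inf {t | p t}`, which is `⊤` (infinity) if there is no such `t`. -/
def firstTime (p : ℕ → Prop) : WithTop ℕ := ⨅ (t : ℕ) (_ : p t), (t : WithTop ℕ)

/-- A finite graph with labelled vertices in `V`, given by its vertex set and edge set. -/
@[ext]
structure PartialTree (V : Type*) where
  verts : Finset V
  edges : Finset (Sym2 V)
deriving DecidableEq

/-- Labelled partial trees carry the discrete σ-algebra. -/
instance (V : Type*) : MeasurableSpace (PartialTree V) := ⊤

/-! ### The Aldous–Broder algorithm

In this part `x : ℕ → V` is a trajectory of the walk. -/

namespace AldousBroder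

variable {V : Type*} [Fintype V] [DecidableEq V]

/-- The set `{x 0, …, x t}` of vertices visited up to time `t`. -/
def visited (x : ℕ → V) (t : ℕ) : Finset V := (Finset.range (t + 1)).image x

/-- The cover time. -/
def coverTime (x : ℕ → V) : WithTop ℕ := firstTime fun t => visited x t = Finset.univ

/-- The first time after `s` at which a vertex is visited for the first time,
capped at the cover time. -/
def outTime (x : ℕ → V) (s : WithTop ℕ) : WithTop ℕ :=
  firstTime (fun t => s < t ∧ x t ∉ visited x (t - 1)) ⊓ coverTime x

/-- The first time after `s` at which an already visited vertex is visited,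
capped at the cover time. -/
def inTime (x : ℕ → V) (s : WithTop ℕ) : WithTop ℕ :=
  firstTime (fun t => s < t ∧ x t ∈ visited x (t - 1)) ⊓ coverTime x

/-- The time `σⁱⁿ i` at which the `i`-th branch ends. -/
def sigmaIn (x : ℕ → V) : ℕ → WithTop ℕ
  | 0 => 0
  | i + 1 => inTime x (outTime x (sigmaIn x i))

/-- The tree of the first-entrance edges up to time `t`. -/
def tree (x : ℕ → V) (t : ℕ) : PartialTree V where
  verts := visited x t
  edges := ((Finset.range t).filter fun k => x (k + 1) ∉ visited x k).image
    fun k => s(x k, x (k + 1))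

end AldousBroder

/-! ### Wilson's algorithm -/

namespace Wilson

/-- A state of Wilson's algorithm: the tree built so far, and the trajectory so far of the random
walk that is under way (`[]` if none is). -/
@[ext]
structure State (V : Type*) where
  tree : PartialTree V
  walk : List V
deriving DecidableEq

variable {V : Type*} [Fintype V] [DecidableEq V]

/-- The chronological loop erasure of a walk: whenever the walk returns to a vertex `x` of the
current path, the path is cut back to `x`. -/
def loopErase (w : List V) : List V :=
  w.foldl (fun p x => p.takeWhile (fun y => decide (y ≠ x)) ++ [x]) []

/-- Add the vertices and the edges of a path to a tree. -/
def addPath (T : PartialTree V) (p : List V) : PartialTree V where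
  verts := T.verts ∪ p.toFinset
  edges := T.edges ∪ (List.zipWith (fun u v => s(u, v)) p p.tail).toFinset

/-- The walk under way moves to `x`. If `x` is in the tree then the walk stops and its loop
erasure is added to the tree. -/
def advance (s : State V) (x : V) : State V :=
  if x ∈ s.tree.verts then ⟨addPath s.tree (loopErase (s.walk ++ [x])), []⟩
  else ⟨s.tree, s.walk ++ [x]⟩

/-- The tree `({r}, ∅)`, and no walk under way. -/
def init (r : V) : State V := ⟨⟨{r}, ∅⟩, []⟩

/-- One step of Wilson's algorithm. If the tree is spanning then the algorithm has ended. Otherwise,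
if no walk is under way, one is started at a vertex chosen uniformly among those that are not in
the tree; and if a walk is under way, it makes one step of simple random walk on `G`. -/
def step (G : LoopGraph V) (s : State V) : PMF (State V) :=
  if h : (s.tree.verts)ᶜ.Nonempty then
    match s.walk.getLast? with
    | none => (PMF.uniformOfFinset _ h).map fun v => ⟨s.tree, [v]⟩
    | some u => (G.step u).map (advance s)
  else PMF.pure s

/-- The time at which the tree becomes spanning along the run `w`. -/
def endTime (w : ℕ → State V) : WithTop ℕ := firstTime fun t => (w t).tree.verts = Finset.univ

/-- The time `σ̂ i` at which the `i`-th branch is completed along the run `w`, capped at the end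
of the algorithm. -/
def sigmaHat (w : ℕ → State V) : ℕ → WithTop ℕ
  | 0 => 0
  | i + 1 => firstTime (fun t => sigmaHat w i < t ∧ (w t).walk = []) ⊓ endTime w

end Wilson

end

/-! Let n = |V| and let m be the number of vertices of the current tree T. Whenever the
Aldous–Broder walk steps to a visited vertex, it lands uniformly on T. Hence the next branch hangs
from a uniform vertex u of T and its first vertex is uniform outside T. From then on each step moves
to any given unvisited vertex with probability 1/n, and otherwise ends the branch. So a path p of k
distinct vertices outside T is the branch at u with probability (m + k) / (m (n - m) n^k).

For Wilson's algorithm the returns of the walk to its own loop erasure q must be removed. Let W(q)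
be the mean of E(tree) at the end of the branch, given the loop erasure q so far, and put D(q) = (m
+ |q|) W(q) - ∑ W(q cut back to y), summed over y in q. Cutting q ++ [x] back to a vertex of q
forgets x, so the return terms cancel: D(q) is (m + |q|)/n · ∑ E(T + q + u) over u in T, plus 1/n ·
∑ D(q ++ [x]) over new x (`walkValue_recursion`). Since D([v]) = m W([v]), unrolling along
self-avoiding paths yields the weights above, with the path traversed backwards. The added edges are
undirected, so the two branch laws agree (`mean_walkValue`).

One branch therefore acts on functions of trees by the same operator `branchMean` in both
algorithms, and i branches act by `branchMean^[i]`. This is made rigorous by optional stopping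
(`IsMarkovChain.lintegral_stopped`), applied to the martingales `stateValue` for Wilson and
`pathValue` for Aldous–Broder. Both stopped means equal `branchMean^[i] F ⟨{r}, ∅⟩`, and the
functions F with values in [0, 1] determine the law. Almost sure finiteness comes from a nonnegative
functional with drift at most -1/n (`ae_exists_not_of_drift`). -/

noncomputable section

/-! ### Functionals of a discrete-time process with countable state space -/

section PathFunctionals

variable {Ω S : Type*} [m : MeasurableSpace Ω] {X : ℕ → Ω → S}

/-- The trajectory that follows `a` up to time `t` and then stays put. -/
def extendPath {t : ℕ} (a : Fin (t + 1) → S) (k : ℕ) : S :=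
  a ⟨min k t, by omega⟩

/-- The first `t + 1` values of a trajectory. -/
def restrictPath (t : ℕ) (x : ℕ → S) : Fin (t + 1) → S := fun k => x k

theorem extendPath_restrictPath {t k : ℕ} (x : ℕ → S) (hk : k ≤ t) :
    extendPath (restrictPath t x) k = x k := by
  simp [extendPath, restrictPath, hk]

theorem restrictPath_eq_iff {t : ℕ} (x : ℕ → S) (a : Fin (t + 1) → S) :
    restrictPath t x = a ↔ ∀ k ≤ t, x k = extendPath a k := by
  constructor
  · rintro rfl k hk
    exact (extendPath_restrictPath x hk).symm
  · intro h
    funext k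
    have hk : (k : ℕ) ≤ t := by omega
    simpa [extendPath, restrictPath, hk] using h k hk

/-- The functional factors through the first `t + 1` values, which range over a countable discrete
space, where every map is measurable. -/
theorem DependsOn.measurable_past [Countable S] {β : Type*} [MeasurableSpace β]
    (hX : ∀ t, Measurable[m, ⊤] (X t)) {t : ℕ} {f : (ℕ → S) → β} (hf : DependsOn f (Set.Iic t)) :
    Measurable[pastFiltration X hX t] fun ω => f fun k => X k ω := by
  let _ : MeasurableSpace S := ⊤
  have hH : Measurable[pastFiltration X hX t] fun ω => restrictPath t fun k => X k ω := by
    refine @measurable_pi_lambda _ _ _ (_) _ _ fun k => ?_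
    have h1 : MeasurableSpace.comap (X k) ⊤ ≤ pastFiltration X hX t :=
      le_iSup₂_of_le (f := fun j (_ : j ≤ t) => MeasurableSpace.comap (X j) ⊤) (k : ℕ)
        (by omega) le_rfl
    exact fun s hs => h1 _ ⟨s, hs, rfl⟩
  have h2 : (fun ω => f fun k => X k ω) =
      (fun a : Fin (t + 1) → S => f (extendPath a)) ∘ fun ω => restrictPath t fun k => X k ω := by
    funext ω
    exact hf fun k hk => (extendPath_restrictPath (fun k => X k ω) hk).symm
  rw [h2]
  exact (Measurable.of_discrete).comp hH

theorem DependsOn.measurable_path [Countable S] {β : Type*} [MeasurableSpace β]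
    (hX : ∀ t, Measurable[m, ⊤] (X t)) {t : ℕ} {f : (ℕ → S) → β} (hf : DependsOn f (Set.Iic t)) :
    Measurable fun ω => f fun k => X k ω :=
  (hf.measurable_past hX).mono ((pastFiltration X hX).le t) le_rfl

theorem DependsOn.update_eq {β : Type*} {t k : ℕ} (htk : t < k) {f : (ℕ → S) → β}
    (hf : DependsOn f (Set.Iic t)) (x : ℕ → S) (s : S) : f (Function.update x k s) = f x :=
  hf fun j hj => Function.update_of_ne (by have : j ≤ t := hj; omega) _ _

end PathFunctionals

/-! ### Markov chains -/

namespace IsMarkovChain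

variable {Ω S : Type*} [MeasurableSpace Ω] [DecidableEq S] [Countable S] {P : Measure Ω}
  {K : S → PMF S} {s₀ : S} {X : ℕ → Ω → S}

/-- The one-step Markov property, for functionals of the trajectory up to time `t + 1`. -/
theorem lintegral_succ (hX : IsMarkovChain P K s₀ X) (t : ℕ) {φ : (ℕ → S) → ENNReal}
    (hφ : DependsOn φ (Set.Iic (t + 1))) :
    ∫⁻ ω, φ (fun k => X k ω) ∂P =
      ∫⁻ ω, ∑' s, K (X t ω) s * φ (Function.update (fun k => X k ω) (t + 1) s) ∂P := by
  let _ : MeasurableSpace S := ⊤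
  have hH : Measurable fun ω => restrictPath t fun k => X k ω :=
    measurable_pi_lambda _ fun k => hX.measurable k
  have hH1 : Measurable fun ω => ((restrictPath t fun k => X k ω), X (t + 1) ω) :=
    hH.prodMk (hX.measurable (t + 1))
  -- The Markov property for a single path: `path_law` gains one factor. The rest sums this over the
  -- countably many paths.
  have hlaw1 : ∀ (a : Fin (t + 1) → S) (s : S),
      P {ω | restrictPath t (fun k => X k ω) = a ∧ X (t + 1) ω = s} =
      P {ω | restrictPath t (fun k => X k ω) = a} * K (extendPath a t) s := by
    intro a s
    have h0 := hX.path_law (t + 1) (Function.update (extendPath a) (t + 1) s)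
    have h1 := hX.path_law t (extendPath a)
    simp only [restrictPath_eq_iff]
    have hset : {ω | ∀ k ≤ t + 1, X k ω = Function.update (extendPath a) (t + 1) s k} =
        {ω | (∀ k ≤ t, X k ω = extendPath a k) ∧ X (t + 1) ω = s} := by
      ext ω
      simp only [Set.mem_ofPred_eq]
      constructor
      · intro h
        refine ⟨fun k hk => ?_, ?_⟩
        · rw [h k (by omega), Function.update_of_ne (by omega)]
        · rw [h (t + 1) le_rfl, Function.update_self]
      · rintro ⟨h, h'⟩ k hk
        rcases Nat.lt_or_ge t k with hk' | hk'
        · obtain rfl : k = t + 1 := by omega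
          rw [Function.update_self, h']
        · rw [h k hk', Function.update_of_ne (by omega)]
    rw [hset] at h0
    rw [h0, h1, Finset.prod_range_succ, ← mul_assoc]
    congr 1
    · congr 1
      refine Finset.prod_congr rfl fun k hk => ?_
      have := Finset.mem_range.1 hk
      rw [Function.update_of_ne (by omega), Function.update_of_ne (by omega)]
    · rw [Function.update_self, Function.update_of_ne (by omega)]
  have e1 : ∫⁻ ω, φ (fun k => X k ω) ∂P = ∑' (a : Fin (t + 1) → S) (s : S),
      φ (Function.update (extendPath a) (t + 1) s) *
        (P {ω | restrictPath t (fun k => X k ω) = a} * K (extendPath a t) s) := by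
    have : ∀ ω, φ (fun k => X k ω) = (fun q : (Fin (t + 1) → S) × S =>
        φ (Function.update (extendPath q.1) (t + 1) q.2))
        ((restrictPath t fun k => X k ω), X (t + 1) ω) := by
      intro ω
      refine hφ fun k hk => ?_
      have hk : k ≤ t + 1 := hk
      rcases Nat.lt_or_ge t k with hk' | hk'
      · obtain rfl : k = t + 1 := by omega
        simp
      · dsimp only
        rw [Function.update_of_ne (by omega), extendPath_restrictPath _ hk']
    simp_rw [this]
    rw [← lintegral_map (f := fun q : (Fin (t + 1) → S) × S =>
        φ (Function.update (extendPath q.1) (t + 1) q.2)) Measurable.of_discrete hH1,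
      lintegral_countable', ENNReal.tsum_prod']
    refine tsum_congr fun a => tsum_congr fun s => ?_
    rw [Measure.map_apply hH1 (measurableSet_singleton _), ← hlaw1]
    congr 2
    ext ω
    simp
  have e2 : ∫⁻ ω, ∑' s, K (X t ω) s * φ (Function.update (fun k => X k ω) (t + 1) s) ∂P =
      ∑' a : Fin (t + 1) → S,
        (∑' s, K (extendPath a t) s * φ (Function.update (extendPath a) (t + 1) s)) *
        P {ω | restrictPath t (fun k => X k ω) = a} := by
    have : ∀ ω, ∑' s, K (X t ω) s * φ (Function.update (fun k => X k ω) (t + 1) s) =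
        (fun a : Fin (t + 1) → S =>
          ∑' s, K (extendPath a t) s * φ (Function.update (extendPath a) (t + 1) s))
        (restrictPath t fun k => X k ω) := by
      intro ω
      refine tsum_congr fun s => ?_
      rw [extendPath_restrictPath _ le_rfl]
      congr 1
      refine hφ fun k hk => ?_
      have hk : k ≤ t + 1 := hk
      rcases Nat.lt_or_ge t k with hk' | hk'
      · obtain rfl : k = t + 1 := by omega
        simp
      · rw [Function.update_of_ne (by omega), Function.update_of_ne (by omega),
          extendPath_restrictPath _ hk']
    simp_rw [this]
    rw [← lintegral_map (f := fun a : Fin (t + 1) → S =>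
          ∑' s, K (extendPath a t) s * φ (Function.update (extendPath a) (t + 1) s))
        Measurable.of_discrete hH,
      lintegral_countable']
    refine tsum_congr fun a => ?_
    rw [Measure.map_apply hH (measurableSet_singleton _)]
    rfl
  rw [e1, e2]
  refine tsum_congr fun a => ?_
  rw [← ENNReal.tsum_mul_right]
  exact tsum_congr fun s => by ring

theorem ae_initial [IsProbabilityMeasure P] (hX : IsMarkovChain P K s₀ X) :
    ∀ᵐ ω ∂P, X 0 ω = s₀ := by
  have h := hX.path_law 0 fun _ => s₀
  simp only [if_true, Finset.range_zero, Finset.prod_empty, mul_one, nonpos_iff_eq_zero,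
    forall_eq] at h
  let _ : MeasurableSpace S := ⊤
  have hm : MeasurableSet {ω | X 0 ω = s₀} := hX.measurable 0 (measurableSet_singleton s₀)
  exact (prob_compl_eq_zero_iff hm).2 h

/-- A property of the initial state that is preserved by every possible transition holds
along almost every trajectory. -/
theorem ae_invariant [IsProbabilityMeasure P] (hX : IsMarkovChain P K s₀ X) {I : S → Prop}
    (h0 : I s₀) (hI : ∀ s s', I s → K s s' ≠ 0 → I s') : ∀ᵐ ω ∂P, ∀ t, I (X t ω) := by
  classical
  rw [ae_all_iff]
  intro t
  induction t with
  | zero => filter_upwards [hX.ae_initial] with ω h; rwa [h]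
  | succ t ih =>
    -- The indicator of violating `I` at time `t + 1` has integral zero, by the one-step formula.
    have hdep : DependsOn (fun x : ℕ → S => if I (x (t + 1)) then (0 : ENNReal) else 1)
        (Set.Iic (t + 1)) := by
      intro x y h
      simp only [h (t + 1) (by simp)]
    have h := hX.lintegral_succ t hdep
    have hz : ∫⁻ ω, ∑' s, K (X t ω) s * (if I (Function.update (fun k => X k ω) (t + 1) s (t + 1))
        then (0 : ENNReal) else 1) ∂P = 0 := by
      refine (lintegral_congr_ae ?_).trans lintegral_zero
      filter_upwards [ih] with ω hω
      refine ENNReal.tsum_eq_zero.2 fun s => ?_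
      rw [Function.update_self]
      by_cases hs : K (X t ω) s = 0
      · simp [hs]
      · simp [hI _ _ hω hs]
    rw [hz, lintegral_eq_zero_iff (hdep.measurable_path hX.measurable)] at h
    filter_upwards [h] with ω hω
    by_contra hc
    simp [hc] at hω

theorem lintegral_zero_time [IsProbabilityMeasure P] (hX : IsMarkovChain P K s₀ X)
    {φ : (ℕ → S) → ENNReal} (hφ : DependsOn φ (Set.Iic 0)) :
    ∫⁻ ω, φ (fun k => X k ω) ∂P = φ fun _ => s₀ := by
  rw [lintegral_congr_ae (g := fun _ => φ fun _ => s₀), lintegral_const, measure_univ, mul_one]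
  filter_upwards [hX.ae_initial] with ω h
  refine hφ fun k hk => ?_
  obtain rfl : k = 0 := by simpa using hk
  exact h

/-- Optional stopping for bounded functionals `g` of the trajectory that have constant conditional
expectation up to the almost surely finite time `τ`. -/
theorem lintegral_stopped [IsProbabilityMeasure P] (hX : IsMarkovChain P K s₀ X) {I : S → Prop}
    (hI : ∀ᵐ ω ∂P, ∀ t, I (X t ω)) {τ : (ℕ → S) → WithTop ℕ}
    (hτ : ∀ t : ℕ, DependsOn (fun x => τ x ≤ t) (Set.Iic t))
    (hfin : ∀ᵐ ω ∂P, τ (fun k => X k ω) < ⊤)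
    {g : ℕ → (ℕ → S) → ENNReal} (hg : ∀ t, DependsOn (g t) (Set.Iic t)) (hg1 : ∀ t x, g t x ≤ 1)
    (hstep : ∀ (t : ℕ) (x : ℕ → S), I (x t) → (t : WithTop ℕ) < τ x →
      ∑' s, K (x t) s * g (t + 1) (Function.update x (t + 1) s) = g t x) :
    ∫⁻ ω, g (τ fun k => X k ω).untopA (fun k => X k ω) ∂P = g 0 fun _ => s₀ := by
  classical
  -- The process `g` frozen at `τ`; its mean is constant in `t`.
  let Z : ℕ → (ℕ → S) → ENNReal := fun t x => if τ x ≤ t then g (τ x).untopA x else g t x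
  have hτeq : ∀ (t : ℕ) (x y : ℕ → S), (∀ k ≤ t, x k = y k) → τ x ≤ t → τ y = τ x := by
    intro t x y hxy hx
    obtain ⟨k, hk⟩ : ∃ k : ℕ, τ x = k := ⟨_, (WithTop.coe_untop _ (hx.trans_lt
      (WithTop.coe_lt_top _)).ne).symm⟩
    rw [hk] at hx ⊢
    have hkt : k ≤ t := WithTop.coe_le_coe.1 hx
    have h1 : ∀ j : ℕ, j ≤ t → (τ x ≤ j ↔ τ y ≤ j) := fun j hj =>
      iff_of_eq (hτ j fun i hi => hxy i (le_trans hi hj))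
    refine le_antisymm ((h1 k hkt).1 hk.le) ?_
    by_contra hlt
    rw [not_le] at hlt
    obtain ⟨j, hj⟩ : ∃ j : ℕ, τ y = j := ⟨_, (WithTop.coe_untop _ (hlt.trans
      (WithTop.coe_lt_top _)).ne).symm⟩
    rw [hj] at hlt
    have hjk : j < k := WithTop.coe_lt_coe.1 hlt
    have := (h1 j (by omega)).2 hj.le
    rw [hk] at this
    exact absurd (Nat.cast_le.1 this) (by omega)
  have huntop : ∀ (t : ℕ) (x : ℕ → S), τ x ≤ t → (τ x).untopA ≤ t := by
    intro t x hx
    obtain ⟨k, hk⟩ : ∃ k : ℕ, τ x = k := ⟨_, (WithTop.coe_untop _ (hx.trans_lt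
      (WithTop.coe_lt_top _)).ne).symm⟩
    rw [hk] at hx ⊢
    exact WithTop.coe_le_coe.1 hx
  have hZ : ∀ t, DependsOn (Z t) (Set.Iic t) := by
    intro t x y hxy
    have h1 : τ x ≤ t ↔ τ y ≤ t := iff_of_eq (hτ t hxy)
    by_cases hx : τ x ≤ t
    · have hy := h1.1 hx
      simp only [Z, if_pos hx, if_pos hy]
      rw [hτeq t x y hxy hx]
      exact hg _ fun k hk => hxy k (le_trans (show k ≤ _ from hk) (huntop t x hx))
    · have hy := fun h => hx (h1.2 h)
      simp only [Z, if_neg hx, if_neg hy]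
      exact hg t hxy
  have hconst : ∀ t, ∫⁻ ω, Z t (fun k => X k ω) ∂P = Z 0 fun _ => s₀ := by
    intro t
    induction t with
    | zero => exact hX.lintegral_zero_time (hZ 0)
    | succ t ih =>
      rw [← ih, hX.lintegral_succ t (hZ (t + 1))]
      refine lintegral_congr_ae ?_
      filter_upwards [hI] with ω hω
      set x : ℕ → S := fun k => X k ω
      change ∑' s, K (x t) s * Z (t + 1) (Function.update x (t + 1) s) = Z t x
      by_cases hx : τ x ≤ t
      · have : ∀ s, Z (t + 1) (Function.update x (t + 1) s) = Z t x := by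
          intro s
          have hagree : ∀ k ≤ t, x k = Function.update x (t + 1) s k := fun k hk =>
            (Function.update_of_ne (by omega) _ _).symm
          have h2 := hτeq t x (Function.update x (t + 1) s) hagree hx
          have h3 : τ x ≤ ((t + 1 : ℕ) : WithTop ℕ) := hx.trans (Nat.cast_le.2 (by omega))
          simp only [Z, h2, if_pos hx, if_pos h3]
          exact (hg _ fun k hk => hagree k (le_trans (show k ≤ _ from hk) (huntop t x hx))).symm
        simp_rw [this]
        rw [ENNReal.tsum_mul_right, PMF.tsum_coe, one_mul]
      · have h1 : Z t x = g t x := if_neg hx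
        rw [h1, ← hstep t x (hω t) (not_le.1 hx)]
        refine tsum_congr fun s => ?_
        congr 1
        simp only [Z]
        split_ifs with h2
        · congr 1
          -- Changing the value at `t + 1` cannot make `τ` occur by time `t`, so here `τ = t + 1`
          -- and freezing has no effect yet.
          have h3 : ¬ τ (Function.update x (t + 1) s) ≤ t := fun h => hx
            ((iff_of_eq (hτ t fun k hk => Function.update_of_ne
              (by have : k ≤ t := hk; omega) _ _)).1 h)
          obtain ⟨k, hk⟩ : ∃ k : ℕ, τ (Function.update x (t + 1) s) = k :=
            ⟨_, (WithTop.coe_untop _ (h2.trans_lt (WithTop.coe_lt_top _)).ne).symm⟩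
          rw [hk] at h2 h3 ⊢
          have h2 : k ≤ t + 1 := WithTop.coe_le_coe.1 h2
          have h3 : ¬ k ≤ t := fun h => h3 (WithTop.coe_le_coe.2 h)
          exact (show k = t + 1 by omega)
        · rfl
  have hZ0 : (Z 0 fun _ => s₀) = g 0 fun _ => s₀ := by
    simp only [Z]
    split_ifs with h
    · congr 1
      exact Nat.le_zero.1 (huntop 0 _ h)
    · rfl
  have hlim : Filter.Tendsto (fun t => ∫⁻ ω, Z t (fun k => X k ω) ∂P) Filter.atTop
      (nhds (∫⁻ ω, g (τ fun k => X k ω).untopA (fun k => X k ω) ∂P)) := by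
    refine tendsto_lintegral_of_dominated_convergence (fun _ => 1)
      (fun t => (hZ t).measurable_path hX.measurable) (fun t => ?_) (by simp) ?_
    · refine Filter.Eventually.of_forall fun ω => ?_
      simp only [Z]
      split_ifs <;> exact hg1 _ _
    · filter_upwards [hfin] with ω hω
      obtain ⟨k, hk⟩ : ∃ k : ℕ, τ (fun k => X k ω) = k := ⟨_, (WithTop.coe_untop _ hω.ne).symm⟩
      refine tendsto_const_nhds.congr' ?_
      filter_upwards [Filter.eventually_ge_atTop k] with t ht
      simp only [Z]
      rw [if_pos]
      rw [hk]
      exact WithTop.coe_le_coe.2 ht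
  simp_rw [hconst] at hlim
  rw [← hZ0]
  exact tendsto_nhds_unique hlim tendsto_const_nhds

/-- If a nonnegative functional decreases by `ε` in mean as long as the process is alive, then
almost surely the process does not live forever. -/
theorem ae_exists_not_of_drift [IsProbabilityMeasure P] (hX : IsMarkovChain P K s₀ X)
    {I : S → Prop} (hI : ∀ᵐ ω ∂P, ∀ t, I (X t ω)) {alive : ℕ → (ℕ → S) → Prop}
    (halive : ∀ t, DependsOn (alive t) (Set.Iic t)) {Z : ℕ → (ℕ → S) → ENNReal}
    (hZ : ∀ t, DependsOn (Z t) (Set.Iic t)) (hZ0 : Z 0 (fun _ => s₀) ≠ ⊤) {ε : ENNReal}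
    (hε : ε ≠ 0)
    (hstep : ∀ t x, I (x t) → alive t x →
      ∑' s, K (x t) s * Z (t + 1) (Function.update x (t + 1) s) + ε ≤ Z t x)
    (hstep' : ∀ t x, I (x t) → ¬ alive t x →
      ∑' s, K (x t) s * Z (t + 1) (Function.update x (t + 1) s) ≤ Z t x) :
    ∀ᵐ ω ∂P, ∃ t, ¬ alive t fun k => X k ω := by
  classical
  set p := P {ω | ∀ t, alive t fun k => X k ω} with hp
  have hmeas : ∀ t, Measurable fun ω => if alive t (fun k => X k ω) then ε else 0 := by
    intro t
    have : DependsOn (fun x => if alive t x then ε else 0) (Set.Iic t) := by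
      intro x y h
      simp only [halive t h]
    exact this.measurable_path hX.measurable
  have hone : ∀ t, p * ε ≤ ∫⁻ ω, (if alive t (fun k => X k ω) then ε else 0) ∂P := by
    intro t
    have h1 : MeasurableSet {ω | alive t fun k => X k ω} :=
      ((halive t).measurable_path hX.measurable).setOf
    have h2 : (fun ω => if alive t (fun k => X k ω) then ε else 0) =
        Set.indicator {ω | alive t fun k => X k ω} fun _ => ε := by
      funext ω
      simp [Set.indicator]
    rw [h2, lintegral_indicator_const h1, mul_comm]
    gcongr
    exact measure_mono fun ω (h : ∀ t, alive t fun k => X k ω) => h t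
  -- At every time the process is alive with probability at least `p`, so each step costs at least
  -- `p * ε` in mean. A finite initial value then forces `p = 0`.
  have hsum : ∀ t : ℕ, (t : ENNReal) * (p * ε) + ∫⁻ ω, Z t (fun k => X k ω) ∂P ≤
      Z 0 fun _ => s₀ := by
    intro t
    induction t with
    | zero => simp [hX.lintegral_zero_time (hZ 0)]
    | succ t ih =>
      refine le_trans ?_ ih
      rw [Nat.cast_succ, add_mul, one_mul, add_assoc]
      gcongr
      calc p * ε + ∫⁻ ω, Z (t + 1) (fun k => X k ω) ∂P
          ≤ ∫⁻ ω, (if alive t (fun k => X k ω) then ε else 0) ∂P +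
            ∫⁻ ω, ∑' s, K (X t ω) s * Z (t + 1) (Function.update (fun k => X k ω) (t + 1) s) ∂P := by
            rw [hX.lintegral_succ t (hZ (t + 1))]
            gcongr
            exact hone t
        _ = ∫⁻ ω, ((if alive t (fun k => X k ω) then ε else 0) +
            ∑' s, K (X t ω) s * Z (t + 1) (Function.update (fun k => X k ω) (t + 1) s)) ∂P :=
            (lintegral_add_left (hmeas t) _).symm
        _ ≤ _ := by
            refine lintegral_mono_ae ?_
            filter_upwards [hI] with ω hω
            split_ifs with h
            · rw [add_comm]
              exact hstep t (fun k => X k ω) (hω t) h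
            · rw [zero_add]
              exact hstep' t (fun k => X k ω) (hω t) h
  have hp0 : p = 0 := by
    by_contra hne
    have hpos : p * ε ≠ 0 := mul_ne_zero hne hε
    obtain ⟨t, ht⟩ := ENNReal.exists_nat_mul_gt hpos hZ0
    exact absurd (le_trans le_self_add (hsum t)) (not_le.2 ht)
  rw [ae_iff]
  simpa only [not_exists, not_not] using hp0

end IsMarkovChain

end

noncomputable section

/-! ### Sums over self-avoiding paths -/

section FreshPaths

variable {V : Type*} [Fintype V] [DecidableEq V]

/-- The lists of distinct vertices outside `A`. -/
def freshPaths (A : Finset V) : Finset (List V) :=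
  ((Finset.univ : Finset {l : List V // l.Nodup}).image Subtype.val).filter fun p => ∀ x ∈ p, x ∉ A

theorem mem_freshPaths {A : Finset V} {p : List V} :
    p ∈ freshPaths A ↔ p.Nodup ∧ ∀ x ∈ p, x ∉ A := by
  simp [freshPaths]

theorem append_mem_freshPaths {A : Finset V} {q : List V} {x : V} (hq : q ∈ freshPaths A)
    (hx : x ∈ (A ∪ q.toFinset)ᶜ) : q ++ [x] ∈ freshPaths A := by
  rw [mem_freshPaths] at hq ⊢
  simp only [Finset.mem_compl, Finset.mem_union, List.mem_toFinset, not_or] at hx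
  refine ⟨?_, ?_⟩
  · rw [List.nodup_append]
    refine ⟨hq.1, by simp, ?_⟩
    rintro a ha b hb rfl
    rw [List.mem_singleton] at hb
    exact hx.2 (hb ▸ ha)
  · intro y hy
    rcases List.mem_append.1 hy with h | h
    · exact hq.2 y h
    · rw [List.mem_singleton.1 h]
      exact hx.1

theorem reverse_mem_freshPaths {A : Finset V} {p : List V} (hp : p ∈ freshPaths A) :
    p.reverse ∈ freshPaths A := by
  simpa [mem_freshPaths] using hp

/-- A fresh path extending `q` is `q` itself or extends `q ++ [x]` for exactly one new vertex `x`.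
-/
theorem sum_freshPaths_prefix {A : Finset V} {q : List V} (hq : q ∈ freshPaths A)
    (Φ : List V → ℝ) :
    ∑ p ∈ (freshPaths A).filter (fun p => q <+: p), Φ p =
      Φ q + ∑ x ∈ (A ∪ q.toFinset)ᶜ, ∑ p ∈ (freshPaths A).filter (fun p => q ++ [x] <+: p), Φ p := by
  have hset : (freshPaths A).filter (fun p => q <+: p) = insert q
      ((A ∪ q.toFinset)ᶜ.biUnion fun x => (freshPaths A).filter fun p => q ++ [x] <+: p) := by
    ext p
    simp only [Finset.mem_filter, Finset.mem_insert, Finset.mem_biUnion]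
    constructor
    · rintro ⟨hp, l, rfl⟩
      rcases l with _ | ⟨x, l⟩
      · left; simp
      · right
        refine ⟨x, ?_, hp, ⟨l, by simp⟩⟩
        rw [mem_freshPaths] at hp
        simp only [Finset.mem_compl, Finset.mem_union, List.mem_toFinset, not_or]
        refine ⟨hp.2 x (by simp), fun hxq => ?_⟩
        exact (List.nodup_append.1 hp.1).2.2 x hxq x (by simp) rfl
    · rintro (rfl | ⟨x, -, hp, h⟩)
      · exact ⟨hq, List.prefix_refl _⟩
      · exact ⟨hp, (List.prefix_append q [x]).trans h⟩
  rw [hset, Finset.sum_insert, Finset.sum_biUnion]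
  · intro x _ y _ hxy
    refine Finset.disjoint_left.2 fun p hp hp' => hxy ?_
    obtain ⟨l, hl⟩ := (Finset.mem_filter.1 hp).2
    obtain ⟨l', hl'⟩ := (Finset.mem_filter.1 hp').2
    rw [← hl', List.append_assoc, List.append_assoc, List.append_cancel_left_eq] at hl
    simpa using (List.cons_eq_cons.1 hl).1
  · intro h
    obtain ⟨x, -, h⟩ := Finset.mem_biUnion.1 h
    have := (Finset.mem_filter.1 h).2.length_le
    simp at this

/-- Unrolling of a linear recursion along self-avoiding paths. -/
theorem eq_sum_freshPaths_of_recursion {A : Finset V} {n : ℝ} {f c : List V → ℝ}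
    (h : ∀ q ∈ freshPaths A, q ≠ [] →
      f q = c q + (∑ x ∈ (A ∪ q.toFinset)ᶜ, f (q ++ [x])) / n)
    {q : List V} (hq : q ∈ freshPaths A) (hq0 : q ≠ []) :
    f q / n ^ q.length = ∑ p ∈ (freshPaths A).filter (fun p => q <+: p), c p / n ^ p.length := by
  induction hN : ((A ∪ q.toFinset)ᶜ).card using Nat.strong_induction_on generalizing q with
  | _ N ih =>
    rw [sum_freshPaths_prefix hq, h q hq hq0, add_div, div_div, ← pow_succ', Finset.sum_div]
    congr 1
    refine Finset.sum_congr rfl fun x hx => ?_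
    rw [← ih _ ?_ (append_mem_freshPaths hq hx) (by simp) rfl]
    · simp
    · rw [← hN]
      refine Finset.card_lt_card (Finset.ssubset_iff_of_subset ?_ |>.2 ⟨x, hx, by simp⟩)
      intro y
      simp +contextual

theorem sum_singleton_eq_sum_freshPaths {A : Finset V} {n : ℝ} {f c : List V → ℝ}
    (h : ∀ q ∈ freshPaths A, q ≠ [] →
      f q = c q + (∑ x ∈ (A ∪ q.toFinset)ᶜ, f (q ++ [x])) / n) :
    (∑ v ∈ Aᶜ, f [v]) / n = ∑ p ∈ (freshPaths A).filter (fun p => p ≠ []), c p / n ^ p.length := by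
  have hnil : ([] : List V) ∈ freshPaths A := by simp [mem_freshPaths]
  -- Giving the empty path the value 0 turns the prefix formula at `[]` into a decomposition of
  -- nonempty paths by their first vertex.
  have h1 := sum_freshPaths_prefix hnil fun p => if p = [] then 0 else c p / n ^ p.length
  simp only [List.nil_prefix, Finset.filter_true, if_true, zero_add, List.toFinset_nil,
    Finset.union_empty, List.nil_append] at h1
  rw [Finset.sum_filter]
  simp only [ne_eq, ite_not]
  rw [h1, Finset.sum_div]
  refine Finset.sum_congr rfl fun v hv => ?_
  have hv' : [v] ∈ freshPaths A := append_mem_freshPaths hnil (by simpa using hv)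
  have h2 := eq_sum_freshPaths_of_recursion h hv' (by simp)
  rw [List.length_singleton, pow_one] at h2
  rw [h2]
  refine Finset.sum_congr rfl fun p hp => ?_
  have hp := (Finset.mem_filter.1 hp).2
  rw [if_neg]
  rintro rfl
  simpa using hp.length_le

theorem sum_freshPaths_reverse {A : Finset V} (Φ : List V → ℝ) :
    ∑ p ∈ (freshPaths A).filter (fun p => p ≠ []), Φ p.reverse =
      ∑ p ∈ (freshPaths A).filter (fun p => p ≠ []), Φ p := by
  refine Finset.sum_nbij' List.reverse List.reverse ?_ ?_ ?_ ?_ ?_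
  · intro p hp
    rw [Finset.mem_filter] at hp ⊢
    exact ⟨reverse_mem_freshPaths hp.1, by simpa using hp.2⟩
  · intro p hp
    rw [Finset.mem_filter] at hp ⊢
    exact ⟨reverse_mem_freshPaths hp.1, by simpa using hp.2⟩
  all_goals simp

end FreshPaths

/-! ### Expected values after a further branch

The functions below give, for a function `E` of labelled trees with values in `[0, 1]`, the
expectation of `E` at the end of the current branch, in the various phases of both algorithms. -/

namespace PartialTree

theorem card_pos_of_mem {V : Type*} [Fintype V] (v : V) : (0 : ℝ) < Fintype.card V := by
  exact_mod_cast Fintype.card_pos_iff.2 ⟨v⟩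

variable {V : Type*} [Fintype V] [DecidableEq V]

/-- Attach the vertex `v` to the vertex `x`. -/
def grow (T : PartialTree V) (x v : V) : PartialTree V where
  verts := insert v T.verts
  edges := insert s(x, v) T.edges

/-- The expected value of `E` at the end of a branch of the Aldous–Broder algorithm which is under
way and has just entered `x`. -/
def outValue (E : PartialTree V → ℝ) (T : PartialTree V) (x : V) : ℝ :=
  (T.verts.card * E T + ∑ v : {v // v ∉ T.verts}, outValue E (T.grow x v) v) / Fintype.card V
termination_by T.vertsᶜ.card
decreasing_by
  refine Finset.card_lt_card ((Finset.ssubset_iff_of_subset ?_).2 ⟨v, by simpa using v.2, by simp [grow]⟩)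
  intro y
  simp +contextual [grow]

theorem outValue_eq (E : PartialTree V → ℝ) (T : PartialTree V) (x : V) :
    outValue E T x = (T.verts.card * E T + ∑ v ∈ T.vertsᶜ, outValue E (T.grow x v) v) /
      Fintype.card V := by
  rw [outValue, Finset.sum_subtype T.vertsᶜ (p := fun v => v ∉ T.verts) (by simp)]

/-- The expected value of `E` at the end of the next branch, if the branch is attached to a
uniformly chosen vertex of `T`. -/
def branchMean (E : PartialTree V → ℝ) (T : PartialTree V) : ℝ :=
  if T.verts = Finset.univ then E T
  else (∑ u ∈ T.verts, ∑ v ∈ T.vertsᶜ, outValue E (T.grow u v) v) /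
    (T.verts.card * T.vertsᶜ.card)

/-- The expected value of `E` at the end of the next branch of the Aldous–Broder algorithm, if the
walk is at `x` and no branch is under way. -/
def inValue (E : PartialTree V → ℝ) (T : PartialTree V) (x : V) : ℝ :=
  if T.verts = Finset.univ then E T
  else (∑ v ∈ T.vertsᶜ, outValue E (T.grow x v) v + T.verts.card * branchMean E T) /
    Fintype.card V

theorem card_verts_add (T : PartialTree V) :
    (T.verts.card : ℝ) + T.vertsᶜ.card = Fintype.card V := by
  exact_mod_cast Finset.card_add_card_compl T.verts

theorem outValue_mem {E : PartialTree V → ℝ} (hE : ∀ T, E T ∈ Set.Icc 0 1) (T : PartialTree V)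
    (x : V) : outValue E T x ∈ Set.Icc 0 1 := by
  induction hN : T.vertsᶜ.card using Nat.strong_induction_on generalizing T x with
  | _ N ih =>
    have hn := card_pos_of_mem x
    have h : ∀ v ∈ T.vertsᶜ, outValue E (T.grow x v) v ∈ Set.Icc 0 1 := by
      intro v hv
      refine ih _ ?_ _ _ rfl
      rw [← hN]
      refine Finset.card_lt_card ((Finset.ssubset_iff_of_subset ?_).2 ⟨v, hv, by simp [grow]⟩)
      intro y
      simp +contextual [grow]
    rw [outValue_eq]
    constructor
    · have := Finset.sum_nonneg fun v hv => (h v hv).1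
      have := (hE T).1
      positivity
    · rw [div_le_one hn, ← card_verts_add T]
      gcongr
      · exact mul_le_of_le_one_right (by positivity) (hE T).2
      · simpa using Finset.sum_le_card_nsmul _ _ _ fun v hv => (h v hv).2

theorem branchMean_mem {E : PartialTree V → ℝ} (hE : ∀ T, E T ∈ Set.Icc 0 1) (T : PartialTree V) :
    branchMean E T ∈ Set.Icc 0 1 := by
  rw [branchMean]
  split_ifs
  · exact hE T
  have h : ∀ u, ∑ v ∈ T.vertsᶜ, outValue E (T.grow u v) v ∈ Set.Icc (0 : ℝ) T.vertsᶜ.card := by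
    intro u
    constructor
    · exact Finset.sum_nonneg fun v _ => (outValue_mem hE _ _).1
    · simpa using Finset.sum_le_card_nsmul _ _ 1 fun v _ => (outValue_mem hE (T.grow u v) v).2
  constructor
  · have := Finset.sum_nonneg fun u (_ : u ∈ T.verts) => (h u).1
    positivity
  · refine div_le_one_of_le₀ ?_ (by positivity)
    simpa using Finset.sum_le_card_nsmul T.verts _ _ fun u _ => (h u).2

theorem inValue_mem {E : PartialTree V → ℝ} (hE : ∀ T, E T ∈ Set.Icc 0 1) (T : PartialTree V)
    (x : V) : inValue E T x ∈ Set.Icc 0 1 := by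
  rw [inValue]
  split_ifs
  · exact hE T
  have hb := branchMean_mem hE T
  constructor
  · have := Finset.sum_nonneg fun v (_ : v ∈ T.vertsᶜ) => (outValue_mem hE (T.grow x v) v).1
    have := hb.1
    positivity
  · rw [div_le_one (card_pos_of_mem x), ← card_verts_add T, add_comm]
    gcongr
    · exact mul_le_of_le_one_right (by positivity) hb.2
    · simpa using Finset.sum_le_card_nsmul _ _ 1 fun v _ => (outValue_mem hE (T.grow x v) v).2

/-- From a uniform vertex of the tree, a step inside the tree leaves the position uniform. So
`branchMean` solves its own one-step equation, although the walk may linger in the tree; this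
justifies the closed form chosen for `inValue`. -/
theorem sum_inValue (E : PartialTree V → ℝ) (T : PartialTree V) (hT : T.verts.Nonempty) :
    ∑ u ∈ T.verts, inValue E T u = T.verts.card * branchMean E T := by
  by_cases hs : T.verts = Finset.univ
  · simp [inValue, branchMean, hs]
  have hm : (T.verts.card : ℝ) ≠ 0 := by
    exact_mod_cast hT.card_pos.ne'
  have hc : (T.vertsᶜ.card : ℝ) ≠ 0 := by
    rwa [Nat.cast_ne_zero, Finset.card_ne_zero, Finset.nonempty_iff_ne_empty, ne_eq,
      Finset.compl_eq_empty_iff]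
  obtain ⟨v, -⟩ := hT
  have hn := (card_pos_of_mem v).ne'
  have hb : ∑ u ∈ T.verts, ∑ v ∈ T.vertsᶜ, outValue E (T.grow u v) v =
      T.verts.card * T.vertsᶜ.card * branchMean E T := by
    rw [branchMean, if_neg hs]
    field_simp
  simp only [inValue, if_neg hs]
  rw [← Finset.sum_div, Finset.sum_add_distrib, hb, Finset.sum_const, nsmul_eq_mul,
    div_eq_iff hn, ← card_verts_add T]
  ring

theorem inValue_eq (E : PartialTree V → ℝ) (T : PartialTree V) (hT : T.verts.Nonempty)
    (hs : T.verts ≠ Finset.univ) (x : V) :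
    inValue E T x = (∑ v ∈ T.vertsᶜ, outValue E (T.grow x v) v + ∑ u ∈ T.verts, inValue E T u) /
      Fintype.card V := by
  rw [sum_inValue E T hT, inValue, if_neg hs]

end PartialTree

/-! ### Paths added to a tree -/

namespace Wilson

open PartialTree

variable {V : Type*}

theorem zipWith_append_pair (q : List V) (v u : V) :
    List.zipWith (fun a b => s(a, b)) (q ++ [v, u]) (q ++ [v, u]).tail =
      List.zipWith (fun a b => s(a, b)) (q ++ [v]) (q ++ [v]).tail ++ [s(v, u)] := by
  induction q with
  | nil => simp
  | cons a q ih =>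
    rcases q with _ | ⟨b, q⟩
    · simp
    · simpa using ih

theorem zipWith_reverse (p : List V) :
    List.zipWith (fun a b => s(a, b)) p.reverse p.reverse.tail =
      (List.zipWith (fun a b => s(a, b)) p p.tail).reverse := by
  induction p with
  | nil => rfl
  | cons a p ih =>
    rcases p with _ | ⟨b, p⟩
    · rfl
    · rw [List.reverse_cons, List.reverse_cons, List.append_assoc, List.singleton_append,
        zipWith_append_pair, ← List.reverse_cons, ih]
      simp [Sym2.eq_swap]

variable [DecidableEq V]

theorem addPath_cons_cons (T : PartialTree V) {u : V} (hu : u ∈ T.verts) (v : V) (q : List V) :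
    addPath T (u :: v :: q) = addPath (T.grow u v) (v :: q) := by
  ext y
  · simp only [addPath, grow, Finset.mem_union, List.mem_toFinset, List.mem_cons,
      Finset.mem_insert]
    constructor
    · rintro (h | rfl | h | h) <;> simp_all
    · rintro ((h | h) | h | h) <;> simp_all
  · simp only [addPath, grow, Finset.mem_union, List.mem_toFinset, List.tail_cons,
      List.zipWith_cons_cons, List.mem_cons, Finset.mem_insert]
    tauto

theorem addPath_singleton (T : PartialTree V) {u : V} (hu : u ∈ T.verts) : addPath T [u] = T := by
  ext y
  · simp only [addPath, Finset.mem_union, List.mem_toFinset, List.mem_singleton]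
    constructor
    · rintro (h | rfl) <;> assumption
    · exact Or.inl
  · simp [addPath]

/-- Edges are unordered pairs. This identifies Wilson's branch, traced towards the tree, with the
Aldous–Broder branch, traced away from it. -/
theorem addPath_reverse (T : PartialTree V) (p : List V) : addPath T p.reverse = addPath T p := by
  rw [addPath, zipWith_reverse, List.toFinset_reverse, List.toFinset_reverse, addPath]

theorem addPath_append_pair (T : PartialTree V) (q : List V) (x y : V) :
    addPath T (q ++ [x, y]) = (addPath T (q ++ [x])).grow x y := by
  ext z
  · simp only [addPath, grow, Finset.mem_union, List.mem_toFinset, List.mem_append, List.mem_cons,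
      Finset.mem_insert, List.not_mem_nil]
    tauto
  · simp only [addPath, grow, Finset.mem_union, List.mem_toFinset, zipWith_append_pair,
      List.mem_append, List.mem_singleton, Finset.mem_insert]
    tauto

/-! ### The loop-erased walk -/

/-- The loop erasure of a walk after a further step to `x`, if the loop erasure before that
is `q`. -/
def loopStep (q : List V) (x : V) : List V :=
  q.takeWhile (fun y => decide (y ≠ x)) ++ [x]

theorem loopErase_append (w : List V) (x : V) :
    loopErase (w ++ [x]) = loopStep (loopErase w) x := by
  simp [loopErase, loopStep, List.foldl_append]

theorem loopStep_of_not_mem {q : List V} {x : V} (hx : x ∉ q) : loopStep q x = q ++ [x] := by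
  rw [loopStep, List.takeWhile_eq_self_iff.2]
  intro y hy
  simpa using fun h : y = x => hx (h ▸ hy)

/-- Cutting back to an earlier vertex forgets the last one, so `q` and all its extensions `q ++ [x]`
share the return terms to vertices of `q`. -/
theorem loopStep_append_of_mem {q : List V} {x y : V} (hy : y ∈ q) :
    loopStep (q ++ [x]) y = loopStep q y := by
  have : q.takeWhile (fun z => decide (z ≠ y)) ≠ q := by
    intro h
    rw [List.takeWhile_eq_self_iff] at h
    simpa using h y hy
  rw [loopStep, loopStep, List.takeWhile_append, if_neg]
  intro h
  exact this ((List.takeWhile_prefix _).eq_of_length h)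

theorem loopStep_singleton_self (v : V) : loopStep [v] v = [v] := by
  simp [loopStep]

variable [Fintype V]

/-- The expected value of `E` at the end of the branch of Wilson's algorithm, counted only if the
walk, whose loop erasure is `q`, reaches the tree within `t` steps. -/
def walkIter (E : PartialTree V → ℝ) (T : PartialTree V) : ℕ → List V → ℝ
  | 0, _ => 0
  | t + 1, q => (∑ u ∈ T.verts, E (addPath T (loopStep q u)) +
      ∑ x ∈ T.vertsᶜ, walkIter E T t (loopStep q x)) / Fintype.card V

/-- The expected value of `E` at the end of the branch of Wilson's algorithm, if the walk under way
has loop erasure `q`. -/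
def walkValue (E : PartialTree V → ℝ) (T : PartialTree V) (q : List V) : ℝ :=
  ⨆ t, walkIter E T t q

theorem walkIter_mem {E : PartialTree V → ℝ} (hE : ∀ T, E T ∈ Set.Icc 0 1) (T : PartialTree V)
    (t : ℕ) (q : List V) : walkIter E T t q ∈ Set.Icc 0 1 := by
  induction t generalizing q with
  | zero => simp [walkIter]
  | succ t ih =>
    rw [walkIter]
    constructor
    · have := Finset.sum_nonneg fun u (_ : u ∈ T.verts) => (hE (addPath T (loopStep q u))).1
      have := Finset.sum_nonneg fun x (_ : x ∈ T.vertsᶜ) => (ih (loopStep q x)).1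
      positivity
    · refine div_le_one_of_le₀ ?_ (by positivity)
      rw [← card_verts_add T]
      gcongr
      · simpa using Finset.sum_le_card_nsmul T.verts _ 1
          fun u _ => (hE (addPath T (loopStep q u))).2
      · simpa using Finset.sum_le_card_nsmul T.vertsᶜ _ 1 fun x _ => (ih (loopStep q x)).2

theorem walkIter_le_succ {E : PartialTree V → ℝ} (hE : ∀ T, E T ∈ Set.Icc 0 1) (T : PartialTree V)
    (t : ℕ) (q : List V) : walkIter E T t q ≤ walkIter E T (t + 1) q := by
  induction t generalizing q with
  | zero => exact (walkIter_mem hE T 1 q).1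
  | succ t ih =>
    rw [walkIter, walkIter]
    gcongr
    exact ih _

theorem tendsto_walkIter {E : PartialTree V → ℝ} (hE : ∀ T, E T ∈ Set.Icc 0 1) (T : PartialTree V)
    (q : List V) :
    Filter.Tendsto (fun t => walkIter E T t q) Filter.atTop (nhds (walkValue E T q)) :=
  tendsto_atTop_ciSup (monotone_nat_of_le_succ fun t => walkIter_le_succ hE T t q)
    ⟨1, by rintro _ ⟨t, rfl⟩; exact (walkIter_mem hE T t q).2⟩

theorem walkValue_mem {E : PartialTree V → ℝ} (hE : ∀ T, E T ∈ Set.Icc 0 1) (T : PartialTree V)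
    (q : List V) : walkValue E T q ∈ Set.Icc 0 1 :=
  isClosed_Icc.mem_of_tendsto (tendsto_walkIter hE T q)
    (Filter.Eventually.of_forall fun t => walkIter_mem hE T t q)

/-- The recursion for the truncated means, passed to the limit. Later arguments use only this
equation and the bounds on `walkValue`; optional stopping supplies the probabilistic meaning. -/
theorem walkValue_eq {E : PartialTree V → ℝ} (hE : ∀ T, E T ∈ Set.Icc 0 1) (T : PartialTree V)
    (q : List V) :
    walkValue E T q = (∑ u ∈ T.verts, E (addPath T (loopStep q u)) +
      ∑ x ∈ T.vertsᶜ, walkValue E T (loopStep q x)) / Fintype.card V := by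
  refine tendsto_nhds_unique
    ((tendsto_walkIter hE T q).comp (Filter.tendsto_add_atTop_nat 1)) ?_
  refine Filter.Tendsto.div_const (Filter.Tendsto.add tendsto_const_nhds ?_) _
  exact tendsto_finsetSum _ fun x _ => tendsto_walkIter hE T _

/-- A function of self-avoiding paths which satisfies a recursion without returns. -/
theorem walkValue_recursion {E : PartialTree V → ℝ} (hE : ∀ T, E T ∈ Set.Icc 0 1)
    (T : PartialTree V) {q : List V} (hq : q ∈ freshPaths T.verts) (hq0 : q ≠ []) :
    ((T.verts.card : ℝ) + q.length) * walkValue E T q -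
        ∑ y ∈ q.toFinset, walkValue E T (loopStep q y) =
      (T.verts.card + q.length) * ((∑ u ∈ T.verts, E (addPath T (q ++ [u]))) / Fintype.card V) +
      (∑ x ∈ (T.verts ∪ q.toFinset)ᶜ,
        ((T.verts.card + (q ++ [x]).length) * walkValue E T (q ++ [x]) -
          ∑ y ∈ (q ++ [x]).toFinset, walkValue E T (loopStep (q ++ [x]) y))) / Fintype.card V := by
  obtain ⟨hnd, hout⟩ := mem_freshPaths.1 hq
  obtain ⟨v, -⟩ := List.exists_mem_of_ne_nil q hq0
  have hn := (card_pos_of_mem v).ne'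
  set R := ∑ y ∈ q.toFinset, walkValue E T (loopStep q y) with hR
  -- Returning from `q ++ [x]` to `x` changes nothing, which uses up the extra unit in the length;
  -- the other returns sum to `R`.
  have h1 : ∀ x ∈ (T.verts ∪ q.toFinset)ᶜ,
      ((T.verts.card + (q ++ [x]).length : ℝ) * walkValue E T (q ++ [x]) -
          ∑ y ∈ (q ++ [x]).toFinset, walkValue E T (loopStep (q ++ [x]) y)) =
      (T.verts.card + q.length) * walkValue E T (q ++ [x]) - R := by
    intro x hx
    simp only [Finset.mem_compl, Finset.mem_union, List.mem_toFinset, not_or] at hx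
    have hself : loopStep (q ++ [x]) x = q ++ [x] := by
      have := (List.takeWhile_eq_self_iff (p := fun y => decide (y ≠ x)) (l := q)).2 (by
        intro y hy; simpa using fun h : y = x => hx.2 (h ▸ hy))
      rw [loopStep, List.takeWhile_append, if_pos (by rw [this])]
      simp
    rw [List.toFinset_append, List.toFinset_cons, List.toFinset_nil, insert_empty_eq,
      Finset.sum_union (by simpa using hx.2), Finset.sum_singleton, hself,
      Finset.sum_congr rfl fun y hy => by rw [loopStep_append_of_mem (List.mem_toFinset.1 hy)],
      ← hR]
    simp only [List.length_append, List.length_singleton, Nat.cast_add, Nat.cast_one]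
    ring
  have h2 : ∑ x ∈ T.vertsᶜ, walkValue E T (loopStep q x) =
      R + ∑ x ∈ (T.verts ∪ q.toFinset)ᶜ, walkValue E T (q ++ [x]) := by
    have hdec : T.vertsᶜ = q.toFinset ∪ (T.verts ∪ q.toFinset)ᶜ := by
      ext y
      simp only [Finset.mem_compl, Finset.mem_union, List.mem_toFinset]
      have := hout y
      tauto
    rw [hdec, Finset.sum_union, hR]
    · congr 1
      refine Finset.sum_congr rfl fun x hx => ?_
      simp only [Finset.mem_compl, Finset.mem_union, List.mem_toFinset, not_or] at hx
      rw [loopStep_of_not_mem hx.2]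
    · refine Finset.disjoint_left.2 fun y hy hy' => ?_
      simp only [Finset.mem_compl, Finset.mem_union, not_or] at hy'
      exact hy'.2 hy
  have h3 : ∑ u ∈ T.verts, E (addPath T (loopStep q u)) =
      ∑ u ∈ T.verts, E (addPath T (q ++ [u])) :=
    Finset.sum_congr rfl fun u hu => by
      rw [loopStep_of_not_mem fun h => hout u h hu]
  have h4 : ((T.verts ∪ q.toFinset)ᶜ.card : ℝ) =
      Fintype.card V - T.verts.card - q.length := by
    have := Finset.card_add_card_compl (T.verts ∪ q.toFinset)
    rw [Finset.card_union_of_disjoint, List.toFinset_card_of_nodup hnd] at this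
    · rw [← this]
      push_cast
      ring
    · refine Finset.disjoint_left.2 fun y hy hy' => ?_
      exact hout y (List.mem_toFinset.1 hy') hy
  have h5 := walkValue_eq hE T q
  rw [h2, h3] at h5
  -- With k = |q|, after multiplication by n, `R` has coefficient (m + k) - n on the left, and on
  -- the right -(n - m - k), one -1 for each new vertex: these agree.
  rw [Finset.sum_congr rfl h1, Finset.sum_sub_distrib, ← Finset.mul_sum, Finset.sum_const,
    nsmul_eq_mul, h4, h5]
  field_simp
  ring

/-- The walk stands at the last vertex of `q`, and any of the m + |q| vertices now in the tree ends
the branch. -/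
theorem outValue_recursion (E : PartialTree V → ℝ) (T : PartialTree V) {u : V}
    (hu : u ∈ T.verts) {q : List V} (hq : q ∈ freshPaths T.verts) (hq0 : q ≠ []) :
    outValue E (addPath T (u :: q)) (q.getLastD u) =
      (T.verts.card + q.length) * E (addPath T (u :: q)) / Fintype.card V +
      (∑ x ∈ (T.verts ∪ q.toFinset)ᶜ,
        outValue E (addPath T (u :: (q ++ [x]))) ((q ++ [x]).getLastD u)) / Fintype.card V := by
  obtain ⟨hnd, hout⟩ := mem_freshPaths.1 hq
  have hverts : (addPath T (u :: q)).verts = T.verts ∪ q.toFinset := by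
    ext y
    simp only [addPath, Finset.mem_union, List.mem_toFinset, List.mem_cons]
    constructor
    · rintro (h | rfl | h) <;> simp_all
    · rintro (h | h) <;> simp_all
  have hcard : ((T.verts ∪ q.toFinset).card : ℝ) = T.verts.card + q.length := by
    rw [Finset.card_union_of_disjoint, List.toFinset_card_of_nodup hnd, Nat.cast_add]
    refine Finset.disjoint_left.2 fun y hy hy' => ?_
    exact hout y (List.mem_toFinset.1 hy') hy
  rw [outValue_eq, add_div, hverts, hcard]
  congr 2
  refine Finset.sum_congr rfl fun x _ => ?_
  obtain ⟨q', z, rfl⟩ := (List.eq_nil_or_concat q).resolve_left hq0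
  rw [List.concat_eq_append, List.append_assoc, List.singleton_append, ← List.cons_append,
    ← List.cons_append, addPath_append_pair]
  simp [List.getLastD_eq_getLast?]

/-- The branches of both algorithms have the same law. -/
theorem mean_walkValue {E : PartialTree V → ℝ} (hE : ∀ T, E T ∈ Set.Icc 0 1)
    (T : PartialTree V) (hT : T.verts.Nonempty) (hs : T.verts ≠ Finset.univ) :
    (∑ v ∈ T.vertsᶜ, walkValue E T [v]) / T.vertsᶜ.card = branchMean E T := by
  have hm : (T.verts.card : ℝ) ≠ 0 := by
    exact_mod_cast hT.card_pos.ne'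
  have hc : (T.vertsᶜ.card : ℝ) ≠ 0 := by
    rwa [Nat.cast_ne_zero, Finset.card_ne_zero, Finset.nonempty_iff_ne_empty, ne_eq,
      Finset.compl_eq_empty_iff]
  have hn : (Fintype.card V : ℝ) ≠ 0 := (card_pos_of_mem hT.choose).ne'
  have hW := sum_singleton_eq_sum_freshPaths fun q hq hq0 => walkValue_recursion hE T hq hq0
  have hAB := fun u (hu : u ∈ T.verts) =>
    sum_singleton_eq_sum_freshPaths fun q hq hq0 => outValue_recursion E T hu hq hq0
  have key : (∑ v ∈ T.vertsᶜ, (T.verts.card : ℝ) * walkValue E T [v]) / Fintype.card V =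
      (∑ u ∈ T.verts, ∑ v ∈ T.vertsᶜ, outValue E (T.grow u v) v) / Fintype.card V := by
    -- The only return from `[v]` is to `v` and leaves `[v]` as it is, so the coefficient m + 1
    -- drops to m.
    have e1 : ∀ v, (T.verts.card : ℝ) * walkValue E T [v] =
        (T.verts.card + ([v] : List V).length) * walkValue E T [v] -
          ∑ y ∈ [v].toFinset, walkValue E T (loopStep [v] y) := by
      intro v
      simp only [List.toFinset_cons, List.toFinset_nil, insert_empty_eq, Finset.sum_singleton,
        loopStep_singleton_self, List.length_singleton, Nat.cast_one]
      ring
    rw [Finset.sum_congr rfl fun v _ => e1 v, hW, Finset.sum_div]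
    have e2 : ∀ u ∈ T.verts, (∑ v ∈ T.vertsᶜ, outValue E (T.grow u v) v) / Fintype.card V =
        ∑ p ∈ (freshPaths T.verts).filter (fun p => p ≠ []),
          (T.verts.card + p.length) * E (addPath T (p ++ [u])) / Fintype.card V /
            (Fintype.card V : ℝ) ^ p.length := by
      intro u hu
      -- Aldous–Broder lists the branch from `u` outwards, Wilson lists it towards `u`.
      rw [← sum_freshPaths_reverse]
      rw [Finset.sum_congr rfl (g := fun v => outValue E (addPath T [u, v]) ([v].getLastD u))]
      · rw [hAB u hu]
        refine Finset.sum_congr rfl fun p _ => ?_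
        rw [← addPath_reverse]
        simp
      · intro v _
        rw [addPath_cons_cons T hu, addPath_singleton _ (by simp [grow])]
        simp
    rw [Finset.sum_congr rfl e2, Finset.sum_comm]
    refine Finset.sum_congr rfl fun p _ => ?_
    rw [← Finset.sum_div, ← Finset.sum_div, ← Finset.mul_sum]
    ring
  rw [div_left_inj' hn, ← Finset.mul_sum] at key
  rw [branchMean, if_neg hs, ← key]
  field_simp

end Wilson

end

noncomputable section

/-! ### Random times determined by a trajectory -/

theorem firstTime_le_iff {p : ℕ → Prop} {t : ℕ} : firstTime p ≤ t ↔ ∃ s ≤ t, p s := by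
  constructor
  · intro h
    by_contra hc
    push Not at hc
    have h1 : ((t + 1 : ℕ) : WithTop ℕ) ≤ firstTime p := by
      refine le_iInf₂ fun s hs => ?_
      have : t + 1 ≤ s := by
        by_contra hlt
        exact hc s (by omega) hs
      exact Nat.cast_le.2 this
    have := Nat.cast_le.1 (h1.trans h)
    omega
  · rintro ⟨s, hst, hs⟩
    exact (iInf₂_le s hs).trans (Nat.cast_le.2 hst)

theorem firstTime_le_of {p : ℕ → Prop} {t : ℕ} (h : p t) : firstTime p ≤ t :=
  firstTime_le_iff.2 ⟨t, le_rfl, h⟩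

theorem WithTop.lt_natCast_succ_iff {a : WithTop ℕ} {s : ℕ} :
    a < ((s + 1 : ℕ) : WithTop ℕ) ↔ a ≤ s := by
  induction a using WithTop.recTopCoe with
  | top => simp
  | coe a => exact ⟨fun h => Nat.cast_le.2 (Nat.le_of_lt_succ (Nat.cast_lt.1 h)),
      fun h => Nat.cast_lt.2 (Nat.lt_succ_of_le (Nat.cast_le.1 h))⟩

theorem isStoppingTime_of_dependsOn {Ω S : Type*} [m : MeasurableSpace Ω] [Countable S]
    {X : ℕ → Ω → S} (hX : ∀ t, Measurable[m, ⊤] (X t)) {τ : (ℕ → S) → WithTop ℕ}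
    (hτ : ∀ t : ℕ, DependsOn (fun x => τ x ≤ t) (Set.Iic t)) :
    IsStoppingTime (pastFiltration X hX) fun ω => τ fun k => X k ω :=
  fun t => @Measurable.setOf _ (_) _ ((hτ t).measurable_past hX)

theorem measurable_stoppedValue_of_dependsOn {Ω S β : Type*} [m : MeasurableSpace Ω] [Countable S]
    [MeasurableSpace β] {X : ℕ → Ω → S} (hX : ∀ t, Measurable[m, ⊤] (X t))
    {τ : (ℕ → S) → WithTop ℕ} (hτ : ∀ t : ℕ, DependsOn (fun x => τ x ≤ t) (Set.Iic t))
    {f : ℕ → (ℕ → S) → β} (hf : ∀ t, DependsOn (f t) (Set.Iic t)) :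
    Measurable (stoppedValue (fun t ω => f t fun k => X k ω) fun ω => τ fun k => X k ω) := by
  have hle : ∀ t : ℕ, MeasurableSet {ω | τ (fun k => X k ω) ≤ t} := fun t =>
    ((hτ t).measurable_path hX).setOf
  have hτm : Measurable fun ω => τ fun k => X k ω := by
    refine measurable_of_Iic fun a => ?_
    induction a using WithTop.recTopCoe with
    | top => simp
    | coe a => exact hle a
  have h1 : Measurable fun ω => (τ fun k => X k ω).untopA := (Measurable.of_discrete).comp hτm
  have h2 : Measurable fun q : Ω × ℕ => f q.2 fun k => X k q.1 :=
    measurable_from_prod_countable_left fun t => (hf t).measurable_path hX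
  exact h2.comp (measurable_id.prodMk h1)

/-! ### Averages over uniform choices -/

theorem PMF.tsum_map_mul {α β : Type*} (p : PMF α) (f : α → β) (φ : β → ENNReal) :
    ∑' b, p.map f b * φ b = ∑' a, p a * φ (f a) := by
  classical
  simp only [PMF.map_apply, ← ENNReal.tsum_mul_right]
  rw [ENNReal.tsum_comm]
  refine tsum_congr fun a => ?_
  rw [tsum_eq_single (f a)]
  · simp
  · intro b hb
    simp [hb]

theorem PMF.tsum_uniformOfFinset_mul_ofReal {α : Type*} {s : Finset α} (hs : s.Nonempty)
    {φ : α → ℝ} (hφ : ∀ a, 0 ≤ φ a) :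
    ∑' a, PMF.uniformOfFinset s hs a * ENNReal.ofReal (φ a) =
      ENNReal.ofReal ((∑ a ∈ s, φ a) / s.card) := by
  classical
  rw [tsum_eq_sum (s := s)]
  · rw [div_eq_inv_mul, ENNReal.ofReal_mul (by positivity), ENNReal.ofReal_sum_of_nonneg
      fun a _ => hφ a, Finset.mul_sum]
    refine Finset.sum_congr rfl fun a ha => ?_
    rw [PMF.uniformOfFinset_apply_of_mem hs ha, ENNReal.ofReal_inv_of_pos, ENNReal.ofReal_natCast]
    exact_mod_cast hs.card_pos
  · intro a ha
    rw [PMF.uniformOfFinset_apply_of_notMem hs ha, zero_mul]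

theorem LoopGraph.tsum_complete_step_mul_ofReal {V : Type*} [Fintype V] [DecidableEq V]
    (A : Finset V) (v : V) {φ : V → ℝ} (hφ : ∀ a, 0 ≤ φ a) :
    ∑' a, (LoopGraph.complete V).step v a * ENNReal.ofReal (φ a) =
      ENNReal.ofReal ((∑ a ∈ A, φ a + ∑ a ∈ Aᶜ, φ a) / Fintype.card V) := by
  have h : (LoopGraph.complete V).nbrs v = Finset.univ := by
    classical
    exact Finset.filter_true_of_mem fun _ _ => trivial
  have hne : ((LoopGraph.complete V).nbrs v).Nonempty := by
    rw [h]
    exact ⟨v, Finset.mem_univ v⟩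
  rw [LoopGraph.step, dif_pos hne, PMF.tsum_uniformOfFinset_mul_ofReal hne hφ, h,
    Finset.sum_add_sum_compl, Finset.card_univ]

namespace PartialTree

variable {V : Type*} [Fintype V] [DecidableEq V]

theorem iterate_branchMean_mem {F : PartialTree V → ℝ} (hF : ∀ T, F T ∈ Set.Icc 0 1) (k : ℕ) :
    ∀ T, branchMean^[k] F T ∈ Set.Icc 0 1 := by
  induction k with
  | zero => exact hF
  | succ k ih =>
    rw [Function.iterate_succ']
    exact branchMean_mem ih

theorem iterate_branchMean_of_spanning (F : PartialTree V → ℝ) (k : ℕ) {T : PartialTree V}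
    (hT : T.verts = Finset.univ) : branchMean^[k] F T = F T := by
  induction k with
  | zero => rfl
  | succ k ih => rw [Function.iterate_succ_apply', branchMean, if_pos hT, ih]

end PartialTree

end

noncomputable section

/-! ### The run of Wilson's algorithm -/

namespace Wilson

open PartialTree

instance (V : Type*) [Countable V] : Countable (State V) := by
  have : Function.Injective fun s : State V => (s.tree.verts, s.tree.edges, s.walk) := by
    rintro ⟨⟨a, b⟩, c⟩ ⟨⟨a', b'⟩, c'⟩ h
    simpa [Prod.ext_iff, and_assoc] using h
  exact this.countable

variable {V : Type*}

/-- The number of branches completed by time `t`. -/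
def branchCount (w : ℕ → State V) : ℕ → ℕ
  | 0 => 0
  | t + 1 => open Classical in branchCount w t + if (w (t + 1)).walk = [] then 1 else 0

theorem dependsOn_branchCount (t : ℕ) :
    DependsOn (fun w : ℕ → State V => branchCount w t) (Set.Iic t) := by
  induction t with
  | zero => exact fun _ _ _ => rfl
  | succ t ih =>
    intro x y h
    have h1 := ih fun k hk => h k (le_trans (show k ≤ t from hk) (Nat.le_succ t))
    have h2 := h (t + 1) (by simp)
    simp only [branchCount, h2]
    exact congrArg₂ _ h1 rfl

theorem branchCount_mono (w : ℕ → State V) : Monotone (branchCount w) :=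
  monotone_nat_of_le_succ fun _ => Nat.le_add_right _ _

/-- The states in which Wilson's algorithm can be. -/
def Reachable (r : V) (s : State V) : Prop :=
  r ∈ s.tree.verts ∧ ∀ y ∈ s.walk, y ∉ s.tree.verts

theorem reachable_init (r : V) : Reachable r (init r) :=
  ⟨Finset.mem_singleton_self r, fun _ hy => absurd hy List.not_mem_nil⟩

theorem loopErase_subset [DecidableEq V] (w : List V) : loopErase w ⊆ w := by
  induction w using List.reverseRecOn with
  | nil => simp [loopErase]
  | append_singleton w x ih =>
    rw [loopErase_append, loopStep]
    exact List.append_subset.2 ⟨fun y hy => List.mem_append_left _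
      (ih ((List.takeWhile_prefix _).subset hy)), List.subset_append_right _ _⟩

theorem getLast_mem_loopErase [DecidableEq V] {w : List V} (hw : w ≠ []) : w.getLast hw ∈ loopErase w := by
  obtain ⟨w', x, rfl⟩ := (List.eq_nil_or_concat w).resolve_left hw
  simp only [List.concat_eq_append, List.getLast_append_singleton, loopErase_append, loopStep]
  simp

variable [Fintype V]

theorem endTime_le_iff {w : ℕ → State V} {t : ℕ} :
    endTime w ≤ t ↔ ∃ s ≤ t, (w s).tree.verts = Finset.univ := firstTime_le_iff

theorem sigmaHat_le_endTime (w : ℕ → State V) (i : ℕ) : sigmaHat w i ≤ endTime w := by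
  cases i with
  | zero => exact bot_le
  | succ i => exact inf_le_right

/-- Replaces nested first times by a counter determined by the run up to `t`. Once the tree is
spanning the walk of an actual run stays empty and the counter keeps growing; the cap at `endTime`
makes this harmless. -/
theorem sigmaHat_le_iff (w : ℕ → State V) (i t : ℕ) :
    sigmaHat w i ≤ t ↔ endTime w ≤ t ∨ i ≤ branchCount w t := by
  induction i generalizing t with
  | zero => simp [sigmaHat]
  | succ i ih =>
    rw [sigmaHat, inf_le_iff, firstTime_le_iff, or_comm]
    by_cases he : endTime w ≤ t
    · simp [he]
    simp only [he, false_or]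
    have he' : ∀ s ≤ t, ¬ endTime w ≤ s := fun s hs h => he (h.trans (Nat.cast_le.2 hs))
    constructor
    · rintro ⟨s, hst, hs, hw⟩
      rcases s with _ | s
      · exact absurd hs (by simp)
      have h1 := ((ih s).1 (WithTop.lt_natCast_succ_iff.1 hs)).resolve_left (he' s (by omega))
      refine le_trans ?_ (branchCount_mono w hst)
      simp only [branchCount, hw, if_true]
      omega
    · intro h
      induction t with
      | zero => simp [branchCount] at h
      | succ t iht =>
        by_cases hlt : i + 1 ≤ branchCount w t
        · obtain ⟨s, hs, h'⟩ := iht (he' t (by omega)) (fun s hs => he' s (by omega)) hlt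
          exact ⟨s, by omega, h'⟩
        · simp only [branchCount] at h
          split_ifs at h with hw
          · refine ⟨t + 1, le_rfl, WithTop.lt_natCast_succ_iff.2 ((ih t).2 (Or.inr ?_)), hw⟩
            omega
          · omega

theorem dependsOn_sigmaHat_le (i t : ℕ) :
    DependsOn (fun w : ℕ → State V => sigmaHat w i ≤ t) (Set.Iic t) := by
  intro x y h
  simp only [sigmaHat_le_iff, endTime_le_iff]
  rw [show branchCount x t = branchCount y t from dependsOn_branchCount t h]
  congr 1
  refine propext (exists_congr fun s => and_congr_right fun hs => ?_)
  rw [h s hs]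

theorem spanning_or_of_sigmaHat_eq {w : ℕ → State V} {i t : ℕ} (h : sigmaHat w i = t) :
    (w t).tree.verts = Finset.univ ∨ i ≤ branchCount w t := by
  refine ((sigmaHat_le_iff w i t).1 h.le).imp_left fun he => ?_
  obtain ⟨s, hst, hs⟩ := endTime_le_iff.1 he
  have h1 : endTime w ≤ s := firstTime_le_of hs
  have h2 := (sigmaHat_le_endTime w i).trans h1
  rw [h] at h2
  have h3 := Nat.cast_le.1 h2
  rwa [show t = s by omega]

variable [DecidableEq V]

theorem step_of_spanning (G : LoopGraph V) {s : State V} (hs : s.tree.verts = Finset.univ) :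
    step G s = PMF.pure s := by
  rw [step, dif_neg]
  simp [hs]

theorem step_of_walk_eq_nil (G : LoopGraph V) {s : State V} (hs : (s.tree.verts)ᶜ.Nonempty)
    (hw : s.walk = []) :
    step G s = (PMF.uniformOfFinset _ hs).map fun v => ⟨s.tree, [v]⟩ := by
  rw [step, dif_pos hs]
  simp [hw]

theorem step_of_walk_ne_nil (G : LoopGraph V) {s : State V} (hs : (s.tree.verts)ᶜ.Nonempty)
    (hw : s.walk ≠ []) :
    step G s = (G.step (s.walk.getLast hw)).map (advance s) := by
  rw [step, dif_pos hs]
  simp [List.getLast?_eq_getLast_of_ne_nil hw]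

theorem compl_nonempty_iff {T : PartialTree V} :
    T.vertsᶜ.Nonempty ↔ T.verts ≠ Finset.univ := by
  rw [Finset.nonempty_iff_ne_empty, ne_eq, Finset.compl_eq_empty_iff]

theorem reachable_step (G : LoopGraph V) (r : V) {s s' : State V} (h : Reachable r s)
    (hs : step G s s' ≠ 0) : Reachable r s' := by
  by_cases hspan : s.tree.verts = Finset.univ
  · rw [step_of_spanning G hspan, PMF.pure_apply] at hs
    split_ifs at hs with he
    · exact he ▸ h
    · simp at hs
  have hne := compl_nonempty_iff.2 hspan
  by_cases hw : s.walk = []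
  · rw [step_of_walk_eq_nil G hne hw, ← PMF.mem_support_iff, PMF.mem_support_map_iff] at hs
    obtain ⟨v, hv, rfl⟩ := hs
    rw [PMF.mem_support_uniformOfFinset_iff] at hv
    exact ⟨h.1, by simpa using hv⟩
  · rw [step_of_walk_ne_nil G hne hw, ← PMF.mem_support_iff, PMF.mem_support_map_iff] at hs
    obtain ⟨v, -, rfl⟩ := hs
    rw [advance]
    split_ifs with hv
    · exact ⟨Finset.mem_union_left _ h.1, by simp⟩
    · refine ⟨h.1, fun y hy => ?_⟩
      rcases List.mem_append.1 hy with hy | hy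
      · exact h.2 y hy
      · rw [List.mem_singleton.1 hy]
        exact hv

/-- A Lyapunov function for Wilson's algorithm. -/
def potential (s : State V) : ℝ := 2 * s.tree.vertsᶜ.card + if s.walk = [] then 1 else 0

theorem potential_nonneg (s : State V) : 0 ≤ potential s := by
  rw [potential]
  positivity

/-- The new branch contains the last vertex of the walk, which was outside the tree. The vertex term
drops by at least 2, while the indicator of an empty walk contributes 1. -/
theorem potential_advance_le {r : V} {s : State V} (h : Reachable r s) (hw : s.walk ≠ []) (x : V)
    (hx : x ∈ s.tree.verts) : potential (advance s x) ≤ potential s - 1 := by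
  rw [advance, if_pos hx]
  simp only [potential, if_true, if_neg hw]
  have hxw : x ∉ loopErase s.walk := fun hc => h.2 x (loopErase_subset _ hc) hx
  have hlt : (addPath s.tree (loopErase (s.walk ++ [x]))).vertsᶜ.card < s.tree.vertsᶜ.card := by
    refine Finset.card_lt_card ((Finset.ssubset_iff_of_subset ?_).2 ⟨s.walk.getLast hw, ?_, ?_⟩)
    · intro y
      simp +contextual [addPath]
    · rw [Finset.mem_compl]
      exact h.2 _ (List.getLast_mem hw)
    · rw [loopErase_append, loopStep_of_not_mem hxw]
      simp [addPath, getLast_mem_loopErase hw]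
  have : ((addPath s.tree (loopErase (s.walk ++ [x]))).vertsᶜ.card : ℝ) + 1 ≤
      s.tree.vertsᶜ.card := by exact_mod_cast hlt
  linarith

/-- Starting a walk lowers the potential by 1. A step of a walk hits the tree with probability at
least 1/n, because the root is there, and otherwise leaves the potential unchanged. -/
theorem tsum_step_potential {r : V} {s : State V} (h : Reachable r s)
    (hs : s.tree.verts ≠ Finset.univ) :
    ∑' s', step (LoopGraph.complete V) s s' * ENNReal.ofReal (potential s') +
      ENNReal.ofReal (1 / Fintype.card V) ≤ ENNReal.ofReal (potential s) := by
  have hn := card_pos_of_mem r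
  have hn1 : (1 : ℝ) ≤ Fintype.card V := by
    exact_mod_cast Fintype.card_pos_iff.2 ⟨r⟩
  have hne := compl_nonempty_iff.2 hs
  by_cases hw : s.walk = []
  · rw [step_of_walk_eq_nil _ hne hw, PMF.tsum_map_mul,
      PMF.tsum_uniformOfFinset_mul_ofReal hne fun v => potential_nonneg _,
      ← ENNReal.ofReal_add (by
        have := Finset.sum_nonneg fun v (_ : v ∈ s.tree.vertsᶜ) =>
          potential_nonneg (⟨s.tree, [v]⟩ : State V)
        positivity) (by positivity)]
    refine ENNReal.ofReal_le_ofReal ?_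
    have hc : (s.tree.vertsᶜ.card : ℝ) ≠ 0 := by exact_mod_cast hne.card_pos.ne'
    have : 1 / (Fintype.card V : ℝ) ≤ 1 := div_le_one_of_le₀ hn1 hn.le
    simp only [potential, hw, if_true, List.cons_ne_nil, if_false, Finset.sum_const, nsmul_eq_mul,
      add_zero]
    rw [mul_div_cancel_left₀ _ hc]
    linarith
  · rw [step_of_walk_ne_nil _ hne hw, PMF.tsum_map_mul,
      LoopGraph.tsum_complete_step_mul_ofReal s.tree.verts _ fun v => potential_nonneg _,
      ← ENNReal.ofReal_add (by
        have := Finset.sum_nonneg fun v (_ : v ∈ s.tree.verts) => potential_nonneg (advance s v)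
        have := Finset.sum_nonneg fun v (_ : v ∈ s.tree.vertsᶜ) => potential_nonneg (advance s v)
        positivity) (by positivity), ← add_div]
    refine ENNReal.ofReal_le_ofReal ?_
    rw [div_le_iff₀ hn]
    have h1 : ∑ v ∈ s.tree.verts, potential (advance s v) ≤
        s.tree.verts.card * (potential s - 1) := by
      simpa using Finset.sum_le_card_nsmul _ _ _ fun v hv => potential_advance_le h hw v hv
    have h2 : ∑ v ∈ s.tree.vertsᶜ, potential (advance s v) = s.tree.vertsᶜ.card * potential s := by
      rw [Finset.sum_congr rfl fun v hv => ?_, Finset.sum_const, nsmul_eq_mul]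
      rw [advance, if_neg (Finset.mem_compl.1 hv)]
      simp [potential, hw]
    have h3 : (1 : ℝ) ≤ s.tree.verts.card := by
      exact_mod_cast Finset.card_pos.2 ⟨r, h.1⟩
    rw [h2, ← card_verts_add s.tree]
    linarith

theorem ae_endTime_lt_top {Ω : Type*} [MeasurableSpace Ω] {Q : Measure Ω} [IsProbabilityMeasure Q]
    {r : V} {W : ℕ → Ω → State V}
    (hW : IsMarkovChain Q (step (LoopGraph.complete V)) (init r) W) :
    ∀ᵐ ω ∂Q, endTime (fun t => W t ω) < ⊤ := by
  have hinv := hW.ae_invariant (reachable_init r) fun s s' h hs => reachable_step _ r h hs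
  have hn := card_pos_of_mem r
  have := hW.ae_exists_not_of_drift hinv (alive := fun t w => (w t).tree.verts ≠ Finset.univ)
    (Z := fun t w => ENNReal.ofReal (potential (w t))) (ε := ENNReal.ofReal (1 / Fintype.card V))
    (fun t x y h => by simp only [h t (by simp)]) (fun t x y h => by simp only [h t (by simp)])
    ENNReal.ofReal_ne_top (by simpa using hn.ne') ?_ ?_
  · filter_upwards [this] with ω ⟨t, ht⟩
    exact (firstTime_le_of (not_not.1 ht)).trans_lt (WithTop.coe_lt_top t)
  · intro t x hx halive
    simp only [Function.update_self]
    exact tsum_step_potential hx halive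
  · intro t x hx halive
    simp only [Function.update_self]
    rw [step_of_spanning _ (not_not.1 halive), tsum_eq_single (x t)]
    · simp
    · intro s hs
      simp [hs]

/-- The expected value of `F` after `k` further branches of Wilson's algorithm. -/
def stateValue (F : PartialTree V → ℝ) : ℕ → State V → ℝ
  | 0, s => F s.tree
  | k + 1, s => if s.tree.verts = Finset.univ then F s.tree
    else if s.walk = [] then branchMean^[k + 1] F s.tree
    else walkValue (branchMean^[k] F) s.tree (loopErase s.walk)

theorem stateValue_mem {F : PartialTree V → ℝ} (hF : ∀ T, F T ∈ Set.Icc 0 1) (k : ℕ)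
    (s : State V) : stateValue F k s ∈ Set.Icc 0 1 := by
  cases k with
  | zero => exact hF _
  | succ k =>
    rw [stateValue]
    split_ifs
    · exact hF _
    · exact iterate_branchMean_mem hF _ _
    · exact walkValue_mem (iterate_branchMean_mem hF k) _ _

theorem stateValue_of_spanning (F : PartialTree V → ℝ) (k : ℕ) {s : State V}
    (hs : s.tree.verts = Finset.univ) : stateValue F k s = F s.tree := by
  cases k with
  | zero => rfl
  | succ k => rw [stateValue, if_pos hs]

theorem stateValue_of_walk_eq_nil (F : PartialTree V → ℝ) (k : ℕ) {s : State V}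
    (hs : s.walk = []) : stateValue F k s = branchMean^[k] F s.tree := by
  cases k with
  | zero => rfl
  | succ k =>
    by_cases h : s.tree.verts = Finset.univ
    · rw [stateValue, if_pos h, iterate_branchMean_of_spanning F _ h]
    · rw [stateValue, if_neg h, if_pos hs]

/-- The choice of a starting vertex is handled by `mean_walkValue`, a step of the walk by
`walkValue_eq`. An empty walk in the new state signals a completed branch, so one fewer remains. -/
theorem tsum_step_stateValue {F : PartialTree V → ℝ} (hF : ∀ T, F T ∈ Set.Icc 0 1) (k : ℕ)
    {s : State V} (hT : s.tree.verts.Nonempty) (hs : s.tree.verts ≠ Finset.univ) :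
    ∑' s', step (LoopGraph.complete V) s s' *
      ENNReal.ofReal (stateValue F (if s'.walk = [] then k else k + 1) s') =
      ENNReal.ofReal (stateValue F (k + 1) s) := by
  have hne := compl_nonempty_iff.2 hs
  have hE := iterate_branchMean_mem hF k
  by_cases hw : s.walk = []
  · rw [step_of_walk_eq_nil _ hne hw, PMF.tsum_map_mul,
      PMF.tsum_uniformOfFinset_mul_ofReal hne fun v => (stateValue_mem hF _ _).1,
      stateValue_of_walk_eq_nil F _ hw, Function.iterate_succ_apply',
      ← mean_walkValue hE s.tree hT hs]
    congr 2
    refine Finset.sum_congr rfl fun v _ => ?_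
    rw [if_neg (by simp), stateValue, if_neg hs, if_neg (by simp)]
    rfl
  · obtain ⟨u, hu⟩ := hT
    rw [step_of_walk_ne_nil _ hne hw, PMF.tsum_map_mul,
      LoopGraph.tsum_complete_step_mul_ofReal s.tree.verts _ fun v => (stateValue_mem hF _ _).1,
      stateValue, if_neg hs, if_neg hw, walkValue_eq hE]
    congr 3
    · refine Finset.sum_congr rfl fun v hv => ?_
      rw [advance, if_pos hv, if_pos rfl, stateValue_of_walk_eq_nil F _ rfl, loopErase_append]
    · refine Finset.sum_congr rfl fun v hv => ?_
      rw [advance, if_neg (Finset.mem_compl.1 hv), if_neg (by simp), stateValue, if_neg hs,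
        if_neg (by simp), loopErase_append]

theorem lintegral_stopped_tree {Ω : Type*} [MeasurableSpace Ω] {Q : Measure Ω}
    [IsProbabilityMeasure Q] {r : V} {W : ℕ → Ω → State V}
    (hW : IsMarkovChain Q (step (LoopGraph.complete V)) (init r) W)
    {F : PartialTree V → ℝ} (hF : ∀ T, F T ∈ Set.Icc 0 1) (i : ℕ) :
    ∫⁻ ω, ENNReal.ofReal (F (stoppedValue (fun t ω => (W t ω).tree)
        (fun ω => sigmaHat (fun t => W t ω) i) ω)) ∂Q =
      ENNReal.ofReal (branchMean^[i] F ⟨{r}, ∅⟩) := by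
  have hinv := hW.ae_invariant (reachable_init r) fun s s' h hs => reachable_step _ r h hs
  have hfin : ∀ᵐ ω ∂Q, sigmaHat (fun t => W t ω) i < ⊤ := by
    filter_upwards [ae_endTime_lt_top hW] with ω hω
    exact (sigmaHat_le_endTime _ i).trans_lt hω
  have key := hW.lintegral_stopped hinv (τ := fun w => sigmaHat w i)
    (dependsOn_sigmaHat_le i) hfin
    (g := fun t w => ENNReal.ofReal (stateValue F (i - branchCount w t) (w t)))
    (fun t x y h => by
      simp only [h t (by simp), show branchCount x t = branchCount y t from
        dependsOn_branchCount t h])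
    (fun t w => ENNReal.ofReal_le_one.2 (stateValue_mem hF _ _).2) ?_
  · rw [show branchMean^[i] F ⟨{r}, ∅⟩ = stateValue F i (init r) from
      (stateValue_of_walk_eq_nil F i (s := init r) rfl).symm]
    simp only [branchCount, Nat.sub_zero] at key
    rw [← key]
    refine lintegral_congr_ae ?_
    filter_upwards [hfin] with ω hω
    obtain ⟨t, ht⟩ : ∃ t : ℕ, sigmaHat (fun t => W t ω) i = t :=
      ⟨_, (WithTop.coe_untop _ hω.ne).symm⟩
    simp only [stoppedValue]
    congr 1
    rcases spanning_or_of_sigmaHat_eq ht with h | h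
    · rw [ht]
      exact (stateValue_of_spanning F _ h).symm
    · rw [ht]
      change _ = stateValue F (i - branchCount (fun t => W t ω) t) (W t ω)
      rw [Nat.sub_eq_zero_of_le h]
      rfl
  · intro t x hx ht
    rw [← not_le, sigmaHat_le_iff, not_or, endTime_le_iff] at ht
    obtain ⟨h1, h2⟩ := ht
    have hs : (x t).tree.verts ≠ Finset.univ := fun h => h1 ⟨t, le_rfl, h⟩
    -- Before the stopping time at least one branch is missing, so the truncated subtraction is a
    -- true one.
    obtain ⟨k, hk⟩ : ∃ k, i - branchCount x t = k + 1 := ⟨i - branchCount x t - 1, by omega⟩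
    rw [hk, ← tsum_step_stateValue hF k ⟨r, hx.1⟩ hs]
    refine tsum_congr fun s => ?_
    have h3 : branchCount (Function.update x (t + 1) s) t = branchCount x t :=
      (dependsOn_branchCount t).update_eq (Nat.lt_succ_self t) x s
    simp only [branchCount, Function.update_self, h3]
    congr 3
    split_ifs <;> omega

end Wilson

end

noncomputable section

/-! ### The Aldous–Broder walk -/

namespace AldousBroder

open PartialTree

section Trajectory

variable {V : Type*} [DecidableEq V]

theorem visited_succ (x : ℕ → V) (t : ℕ) :
    visited x (t + 1) = insert (x (t + 1)) (visited x t) := by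
  rw [visited, Finset.range_add_one, Finset.image_insert, visited]

theorem mem_visited (x : ℕ → V) (t : ℕ) : x t ∈ visited x t :=
  Finset.mem_image_of_mem x (Finset.mem_range.2 (Nat.lt_succ_self t))

theorem dependsOn_visited (t : ℕ) : DependsOn (fun x : ℕ → V => visited x t) (Set.Iic t) := by
  intro x y h
  exact Finset.image_congr fun k hk => h k (by
    have := Finset.mem_range.1 hk
    exact Nat.lt_succ_iff.1 this)

theorem tree_zero (x : ℕ → V) : tree x 0 = ⟨{x 0}, ∅⟩ := by
  simp [tree, visited]

theorem tree_succ_of_mem {x : ℕ → V} {t : ℕ} (h : x (t + 1) ∈ visited x t) :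
    tree x (t + 1) = tree x t := by
  ext1
  · simp only [tree]
    rw [visited_succ, Finset.insert_eq_of_mem h]
  · simp only [tree]
    rw [Finset.range_add_one, Finset.filter_insert, if_neg (not_not.2 h)]

theorem tree_succ_of_notMem {x : ℕ → V} {t : ℕ} (h : x (t + 1) ∉ visited x t) :
    tree x (t + 1) = (tree x t).grow (x t) (x (t + 1)) := by
  ext1
  · simp only [tree, grow]
    rw [visited_succ]
  · simp only [tree, grow]
    rw [Finset.range_add_one, Finset.filter_insert, if_pos h, Finset.image_insert]

theorem dependsOn_tree (t : ℕ) : DependsOn (fun x : ℕ → V => tree x t) (Set.Iic t) := by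
  induction t with
  | zero =>
    intro x y h
    simp only [tree_zero, h 0 (by simp)]
  | succ t ih =>
    intro x y h
    have h' : ∀ k ∈ Set.Iic t, x k = y k := fun k hk =>
      h k (le_trans (show k ≤ t from hk) (Nat.le_succ t))
    have hv : visited x t = visited y t := dependsOn_visited t h'
    have hT : tree x t = tree y t := ih h'
    have h1 := h (t + 1) (by simp)
    by_cases hx : x (t + 1) ∈ visited x t
    · have hy : y (t + 1) ∈ visited y t := by rwa [← h1, ← hv]
      simp only [tree_succ_of_mem hx, tree_succ_of_mem hy, hT]
    · have hy : y (t + 1) ∉ visited y t := by rwa [← h1, ← hv]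
      simp only [tree_succ_of_notMem hx, tree_succ_of_notMem hy, hT, h1, h' t (by simp)]

/-- A vertex is visited for the first time at the positive time `t`. -/
def Fresh (x : ℕ → V) : ℕ → Prop
  | 0 => False
  | t + 1 => x (t + 1) ∉ visited x t

theorem dependsOn_fresh (t : ℕ) : DependsOn (fun x : ℕ → V => Fresh x t) (Set.Iic t) := by
  cases t with
  | zero => exact fun _ _ _ => rfl
  | succ t =>
    intro x y h
    have hv : visited x t = visited y t := dependsOn_visited t fun k hk =>
      h k (le_trans (show k ≤ t from hk) (Nat.le_succ t))
    simp only [Fresh, hv, h (t + 1) (by simp)]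

open Classical in
/-- The number of branches completed by time `t`. -/
def branchCount (x : ℕ → V) : ℕ → ℕ
  | 0 => 0
  | t + 1 => branchCount x t + if Fresh x t ∧ ¬ Fresh x (t + 1) then 1 else 0

theorem dependsOn_branchCount (t : ℕ) :
    DependsOn (fun x : ℕ → V => branchCount x t) (Set.Iic t) := by
  induction t with
  | zero => exact fun _ _ _ => rfl
  | succ t ih =>
    intro x y h
    have h' : ∀ k ∈ Set.Iic t, x k = y k := fun k hk =>
      h k (le_trans (show k ≤ t from hk) (Nat.le_succ t))
    have h1 : branchCount x t = branchCount y t := ih h'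
    have h2 : Fresh x t = Fresh y t := dependsOn_fresh t h'
    have h3 : Fresh x (t + 1) = Fresh y (t + 1) := dependsOn_fresh (t + 1) h
    classical
    simp only [branchCount, h1]
    exact congrArg₂ _ rfl (if_congr (by rw [h2, h3]) rfl rfl)

theorem branchCount_mono (x : ℕ → V) : Monotone (branchCount x) :=
  monotone_nat_of_le_succ fun _ => Nat.le_add_right _ _

theorem branchCount_succ_of_fresh {x : ℕ → V} {t : ℕ} (h : Fresh x (t + 1)) :
    branchCount x (t + 1) = branchCount x t := by
  simp [branchCount, h]

/-- Somewhere between the two times a fresh step is directly followed by one that is not fresh, and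
there the counter increases. -/
theorem branchCount_lt_of_fresh {x : ℕ → V} {s t : ℕ} (hst : s < t) (hs : Fresh x s)
    (ht : ¬ Fresh x t) : branchCount x s < branchCount x t := by
  induction t with
  | zero => omega
  | succ t ih =>
    by_cases hf : Fresh x t
    · have h1 : branchCount x s ≤ branchCount x t := branchCount_mono x (by omega)
      simp only [branchCount, hf, ht, not_false_eq_true, and_self, if_true]
      omega
    · have hne : s ≠ t := by rintro rfl; exact hf hs
      exact (ih (by omega) hf).trans_le (branchCount_mono x (Nat.le_succ t))

end Trajectory

variable {V : Type*} [Fintype V] [DecidableEq V]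

theorem coverTime_le_iff {x : ℕ → V} {t : ℕ} :
    coverTime x ≤ t ↔ ∃ s ≤ t, visited x s = Finset.univ := firstTime_le_iff

theorem sigmaIn_le_coverTime (x : ℕ → V) (i : ℕ) : sigmaIn x i ≤ coverTime x := by
  cases i with
  | zero => exact bot_le
  | succ i => exact inf_le_right

theorem outTime_le_iff {x : ℕ → V} {σ : WithTop ℕ} {t : ℕ} :
    outTime x σ ≤ t ↔ coverTime x ≤ t ∨ ∃ s < t, σ ≤ s ∧ Fresh x (s + 1) := by
  rw [outTime, inf_le_iff, firstTime_le_iff, or_comm]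
  refine or_congr_right ⟨?_, ?_⟩
  · rintro ⟨s, hst, hs, hf⟩
    rcases s with _ | s
    · exact absurd hs (by simp)
    · exact ⟨s, by omega, WithTop.lt_natCast_succ_iff.1 hs, hf⟩
  · rintro ⟨s, hst, hs, hf⟩
    exact ⟨s + 1, hst, WithTop.lt_natCast_succ_iff.2 hs, hf⟩

theorem inTime_le_iff {x : ℕ → V} {σ : WithTop ℕ} {t : ℕ} :
    inTime x σ ≤ t ↔ coverTime x ≤ t ∨ ∃ s < t, σ ≤ s ∧ ¬ Fresh x (s + 1) := by
  rw [inTime, inf_le_iff, firstTime_le_iff, or_comm]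
  refine or_congr_right ⟨?_, ?_⟩
  · rintro ⟨s, hst, hs, hf⟩
    rcases s with _ | s
    · exact absurd hs (by simp)
    · exact ⟨s, by omega, WithTop.lt_natCast_succ_iff.1 hs, not_not.2 hf⟩
  · rintro ⟨s, hst, hs, hf⟩
    exact ⟨s + 1, hst, WithTop.lt_natCast_succ_iff.2 hs, not_not.1 hf⟩

/-- A branch is completed exactly when a fresh step is followed by one that is not, so the
alternating first times reduce to a counter determined by the walk up to `t`, apart from the cap at
the cover time. -/
theorem sigmaIn_le_iff (x : ℕ → V) (i t : ℕ) :
    sigmaIn x i ≤ t ↔ coverTime x ≤ t ∨ i ≤ branchCount x t := by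
  induction i generalizing t with
  | zero => simp [sigmaIn]
  | succ i ih =>
    rw [sigmaIn, inTime_le_iff]
    by_cases he : coverTime x ≤ t
    · simp [he]
    simp only [he, false_or]
    have he' : ∀ s ≤ t, ¬ coverTime x ≤ s := fun s hs h => he (h.trans (Nat.cast_le.2 hs))
    constructor
    · rintro ⟨s, hst, hs, hf⟩
      obtain ⟨k, hks, hk, hfk⟩ := (outTime_le_iff.1 hs).resolve_left (he' s (by omega))
      have h1 := ((ih k).1 hk).resolve_left (he' k (by omega))
      have h2 := branchCount_succ_of_fresh hfk
      have h3 := branchCount_lt_of_fresh (show k + 1 < s + 1 by omega) hfk hf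
      have h4 := branchCount_mono x (show s + 1 ≤ t by omega)
      omega
    · intro h
      clear he
      induction t with
      | zero => simp [branchCount] at h
      | succ t iht =>
        by_cases hlt : i + 1 ≤ branchCount x t
        · obtain ⟨s, hs, h'⟩ := iht (fun s hs => he' s (by omega)) hlt
          exact ⟨s, by omega, h'⟩
        · simp only [branchCount] at h
          split_ifs at h with hw
          · refine ⟨t, by omega, outTime_le_iff.2 (Or.inr ?_), hw.2⟩
            obtain ⟨hf, -⟩ := hw
            rcases t with _ | t
            · exact hf.elim
            · refine ⟨t, by omega, (ih t).2 (Or.inr ?_), hf⟩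
              have := branchCount_succ_of_fresh hf
              omega
          · omega

theorem dependsOn_sigmaIn_le (i t : ℕ) :
    DependsOn (fun x : ℕ → V => sigmaIn x i ≤ t) (Set.Iic t) := by
  intro x y h
  simp only [sigmaIn_le_iff, coverTime_le_iff]
  rw [show branchCount x t = branchCount y t from dependsOn_branchCount t h]
  congr 1
  refine propext (exists_congr fun s => and_congr_right fun hs => ?_)
  rw [show visited x s = visited y s from dependsOn_visited s fun k hk =>
    h k (le_trans (show k ≤ s from hk) hs)]

/-- A fresh step leaves the counter unchanged, so without the cap the `i`-th branch would already
have ended one step earlier. -/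
theorem spanning_or_of_sigmaIn_eq {x : ℕ → V} {i t : ℕ} (h : sigmaIn x i = t) :
    visited x t = Finset.univ ∨ (i ≤ branchCount x t ∧ ¬ Fresh x t) := by
  by_cases hs : visited x t = Finset.univ
  · exact Or.inl hs
  have hcover : ¬ coverTime x ≤ t := by
    intro he
    obtain ⟨s, hst, hs'⟩ := coverTime_le_iff.1 he
    have h1 : coverTime x ≤ s := firstTime_le_of hs'
    have h2 := (sigmaIn_le_coverTime x i).trans h1
    rw [h] at h2
    have h3 := Nat.cast_le.1 h2
    exact hs (by rwa [show t = s by omega])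
  have hcount := ((sigmaIn_le_iff x i t).1 h.le).resolve_left hcover
  refine Or.inr ⟨hcount, fun hf => ?_⟩
  rcases t with _ | t
  · exact hf
  rw [branchCount_succ_of_fresh hf] at hcount
  have h1 := (sigmaIn_le_iff x i t).2 (Or.inr hcount)
  rw [h] at h1
  have := Nat.cast_le.1 h1
  omega

/-- With c unvisited vertices, a step finds a new one with probability c/n, so c decreases in mean
by c/n, which is at least 1/n until the walk has covered `V`. -/
theorem ae_coverTime_lt_top {Ω : Type*} [MeasurableSpace Ω] {P : Measure Ω}
    [IsProbabilityMeasure P] {r : V} {X : ℕ → Ω → V}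
    (hX : IsMarkovChain P (LoopGraph.complete V).step r X) :
    ∀ᵐ ω ∂P, coverTime (fun t => X t ω) < ⊤ := by
  have hn := card_pos_of_mem r
  have hv : ∀ (t : ℕ) (x : ℕ → V) (s : V),
      visited (Function.update x (t + 1) s) (t + 1) = insert s (visited x t) := by
    intro t x s
    rw [visited_succ, Function.update_self]
    congr 1
    exact (dependsOn_visited t).update_eq (Nat.lt_succ_self t) x s
  have hmean : ∀ (t : ℕ) (x : ℕ → V), ∑' s, (LoopGraph.complete V).step (x t) s *
      ENNReal.ofReal ((visited (Function.update x (t + 1) s) (t + 1))ᶜ.card : ℝ) =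
      ENNReal.ofReal ((visited x t)ᶜ.card * (1 - 1 / Fintype.card V)) := by
    intro t x
    simp only [hv]
    rw [LoopGraph.tsum_complete_step_mul_ofReal (visited x t) _ fun s => Nat.cast_nonneg _]
    congr 1
    have h1 : ∀ s ∈ visited x t, ((insert s (visited x t))ᶜ.card : ℝ) = (visited x t)ᶜ.card :=
      fun s hs => by rw [Finset.insert_eq_of_mem hs]
    have h2 : ∀ s ∈ (visited x t)ᶜ, ((insert s (visited x t))ᶜ.card : ℝ) =
        (visited x t)ᶜ.card - 1 := by
      intro s hs
      rw [Finset.compl_insert, Finset.cast_card_erase_of_mem hs]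
    have h3 : ((visited x t).card : ℝ) + (visited x t)ᶜ.card = Fintype.card V :=
      card_verts_add (tree x t)
    rw [Finset.sum_congr rfl h1, Finset.sum_congr rfl h2, Finset.sum_const, Finset.sum_const,
      nsmul_eq_mul, nsmul_eq_mul, eq_sub_of_add_eq h3]
    field_simp
    ring
  have hle : 1 / (Fintype.card V : ℝ) ≤ 1 :=
    div_le_one_of_le₀ (by exact_mod_cast Fintype.card_pos_iff.2 ⟨r⟩) hn.le
  have := hX.ae_exists_not_of_drift (I := fun _ => True) (by simp)
    (alive := fun t x => visited x t ≠ Finset.univ)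
    (Z := fun t x => ENNReal.ofReal ((visited x t)ᶜ.card : ℝ))
    (ε := ENNReal.ofReal (1 / Fintype.card V))
    (fun t x y h => by simp only [show visited x t = visited y t from dependsOn_visited t h])
    (fun t x y h => by simp only [show visited x t = visited y t from dependsOn_visited t h])
    ENNReal.ofReal_ne_top (by simpa using hn.ne') ?_ ?_
  · filter_upwards [this] with ω ⟨t, ht⟩
    exact (firstTime_le_of (not_not.1 ht)).trans_lt (WithTop.coe_lt_top t)
  · intro t x _ halive
    rw [hmean, ← ENNReal.ofReal_add (mul_nonneg (Nat.cast_nonneg _) (by linarith)) (by positivity)]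
    refine ENNReal.ofReal_le_ofReal ?_
    have h1 : (1 : ℝ) ≤ (visited x t)ᶜ.card := by
      rw [Nat.one_le_cast]
      exact Finset.card_pos.2 (Wilson.compl_nonempty_iff (T := tree x t) |>.2 halive)
    have : 0 ≤ ((visited x t)ᶜ.card - 1) * (1 / (Fintype.card V : ℝ)) :=
      mul_nonneg (by linarith) (by positivity)
    linarith
  · intro t x _ _
    rw [hmean]
    refine ENNReal.ofReal_le_ofReal ?_
    exact mul_le_of_le_one_right (Nat.cast_nonneg _) (by linarith [one_div_pos.2 hn])

/-- The expected value of `F` after `k` further branches, if the walk is at `v` and no branch is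
under way. -/
def restValue (F : PartialTree V → ℝ) : ℕ → PartialTree V → V → ℝ
  | 0, T, _ => F T
  | k + 1, T, v => inValue (branchMean^[k] F) T v

theorem restValue_mem {F : PartialTree V → ℝ} (hF : ∀ T, F T ∈ Set.Icc 0 1) (k : ℕ)
    (T : PartialTree V) (v : V) : restValue F k T v ∈ Set.Icc 0 1 := by
  cases k with
  | zero => exact hF T
  | succ k => exact inValue_mem (iterate_branchMean_mem hF k) T v

theorem restValue_of_spanning (F : PartialTree V → ℝ) (k : ℕ) {T : PartialTree V}
    (hT : T.verts = Finset.univ) (v : V) : restValue F k T v = F T := by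
  cases k with
  | zero => rfl
  | succ k => rw [restValue, inValue, if_pos hT, iterate_branchMean_of_spanning F k hT]

/-- A branch that ends by a step back into the tree leaves the walk at a uniform vertex of it;
averaging over this vertex removes the dependence on the position. -/
theorem sum_restValue (F : PartialTree V → ℝ) (k : ℕ) {T : PartialTree V}
    (hT : T.verts.Nonempty) :
    ∑ v ∈ T.verts, restValue F k T v = T.verts.card * branchMean^[k] F T := by
  cases k with
  | zero => simp [restValue]
  | succ k =>
    rw [Function.iterate_succ_apply', ← sum_inValue _ T hT]
    rfl

open Classical in
/-- The conditional expectation of `F` at the end of branch `i`, given the walk up to time `t`. -/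
def pathValue (F : PartialTree V → ℝ) (i t : ℕ) (x : ℕ → V) : ℝ :=
  if Fresh x t then outValue (branchMean^[i - branchCount x t - 1] F) (tree x t) (x t)
  else restValue F (i - branchCount x t) (tree x t) (x t)

theorem pathValue_mem {F : PartialTree V → ℝ} (hF : ∀ T, F T ∈ Set.Icc 0 1) (i t : ℕ)
    (x : ℕ → V) : pathValue F i t x ∈ Set.Icc 0 1 := by
  rw [pathValue]
  split_ifs
  · exact outValue_mem (iterate_branchMean_mem hF _) _ _
  · exact restValue_mem hF _ _ _

theorem dependsOn_pathValue (F : PartialTree V → ℝ) (i t : ℕ) :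
    DependsOn (pathValue F i t) (Set.Iic t) := by
  intro x y h
  have h1 : branchCount x t = branchCount y t := dependsOn_branchCount t h
  have h2 : Fresh x t = Fresh y t := dependsOn_fresh t h
  have h3 : tree x t = tree y t := dependsOn_tree t h
  classical
  simp only [pathValue, h1, h3, h t (by simp)]
  exact if_congr (by rw [h2]) rfl rfl

/-- If the cover time cuts a branch short, `outValue` is still in force, but with no unvisited
vertex left it is just the value at the spanning tree. -/
theorem pathValue_of_sigmaIn_eq (F : PartialTree V → ℝ) {i t : ℕ} {x : ℕ → V}
    (h : sigmaIn x i = t) : pathValue F i t x = F (tree x t) := by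
  have hn := (card_pos_of_mem (x t)).ne'
  rcases spanning_or_of_sigmaIn_eq h with hs | ⟨hc, hf⟩
  · have hs' : (tree x t).verts = Finset.univ := hs
    rw [pathValue]
    split_ifs
    · rw [outValue_eq, hs', iterate_branchMean_of_spanning F _ hs']
      simp [hn]
    · exact restValue_of_spanning F _ hs' _
  · rw [pathValue, if_neg hf, Nat.sub_eq_zero_of_le hc]
    rfl

/-- During a branch, a step back into the tree ends it at a uniform vertex, so `outValue_eq` and
`sum_restValue` apply. Between branches this is the one-step equation `inValue_eq`. -/
theorem tsum_step_pathValue {F : PartialTree V → ℝ} (hF : ∀ T, F T ∈ Set.Icc 0 1) {i t : ℕ}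
    {x : ℕ → V} (hc : branchCount x t < i) (hs : visited x t ≠ Finset.univ) :
    ∑' s, (LoopGraph.complete V).step (x t) s *
      ENNReal.ofReal (pathValue F i (t + 1) (Function.update x (t + 1) s)) =
      ENNReal.ofReal (pathValue F i t x) := by
  rw [LoopGraph.tsum_complete_step_mul_ofReal (visited x t) _ fun s => (pathValue_mem hF _ _ _).1]
  congr 1
  obtain ⟨k, hk⟩ : ∃ k, i - branchCount x t = k + 1 := ⟨i - branchCount x t - 1, by omega⟩
  have hT : (tree x t).verts.Nonempty := ⟨x t, mem_visited x t⟩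
  have hcount : ∀ s, branchCount (Function.update x (t + 1) s) t = branchCount x t :=
    (dependsOn_branchCount t).update_eq (Nat.lt_succ_self t) x
  have hfresh : ∀ s, Fresh (Function.update x (t + 1) s) t = Fresh x t :=
    (dependsOn_fresh t).update_eq (Nat.lt_succ_self t) x
  have htree : ∀ s, tree (Function.update x (t + 1) s) t = tree x t :=
    (dependsOn_tree t).update_eq (Nat.lt_succ_self t) x
  have hfresh' : ∀ s, Fresh (Function.update x (t + 1) s) (t + 1) ↔ s ∉ visited x t := by
    intro s
    rw [Fresh, Function.update_self, show visited (Function.update x (t + 1) s) t = visited x t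
      from (dependsOn_visited t).update_eq (Nat.lt_succ_self t) x s]
  have hnew : ∀ s ∈ (visited x t)ᶜ, pathValue F i (t + 1) (Function.update x (t + 1) s) =
      outValue (branchMean^[k] F) ((tree x t).grow (x t) s) s := by
    intro s hs
    have hf := (hfresh' s).2 (Finset.mem_compl.1 hs)
    rw [pathValue, if_pos hf, branchCount_succ_of_fresh hf, hcount, hk, Nat.add_sub_cancel,
      tree_succ_of_notMem hf, htree, Function.update_self, Function.update_of_ne (by omega)]
  have hold : ∀ s ∈ visited x t, ¬ Fresh (Function.update x (t + 1) s) (t + 1) ∧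
      tree (Function.update x (t + 1) s) (t + 1) = tree x t := by
    intro s hs
    have hf : ¬ Fresh (Function.update x (t + 1) s) (t + 1) := fun h => (hfresh' s).1 h hs
    exact ⟨hf, by rw [tree_succ_of_mem (not_not.1 hf), htree]⟩
  rw [Finset.sum_congr rfl hnew]
  by_cases hfx : Fresh x t
  · have h1 : ∀ s ∈ visited x t, pathValue F i (t + 1) (Function.update x (t + 1) s) =
        restValue F k (tree x t) s := by
      intro s hs
      obtain ⟨hf, hT'⟩ := hold s hs
      rw [pathValue, if_neg hf, hT', Function.update_self, branchCount, hcount,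
        if_pos ⟨by rwa [hfresh], hf⟩, show i - (branchCount x t + 1) = k by omega]
    rw [Finset.sum_congr rfl h1, pathValue, if_pos hfx, hk, Nat.add_sub_cancel, outValue_eq,
      ← sum_restValue F k hT]
    rfl
  · have h1 : ∀ s ∈ visited x t, pathValue F i (t + 1) (Function.update x (t + 1) s) =
        inValue (branchMean^[k] F) (tree x t) s := by
      intro s hs
      obtain ⟨hf, hT'⟩ := hold s hs
      rw [pathValue, if_neg hf, hT', Function.update_self, branchCount, hcount,
        if_neg fun h => hfx ((hfresh s).mp h.1), Nat.add_zero, hk]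
      rfl
    rw [Finset.sum_congr rfl h1, pathValue, if_neg hfx, hk, restValue,
      inValue_eq _ _ hT hs, add_comm]
    rfl

theorem lintegral_stopped_tree {Ω : Type*} [MeasurableSpace Ω] {P : Measure Ω}
    [IsProbabilityMeasure P] {r : V} {X : ℕ → Ω → V}
    (hX : IsMarkovChain P (LoopGraph.complete V).step r X)
    {F : PartialTree V → ℝ} (hF : ∀ T, F T ∈ Set.Icc 0 1) (i : ℕ) :
    ∫⁻ ω, ENNReal.ofReal (F (stoppedValue (fun t ω => tree (fun k => X k ω) t)
        (fun ω => sigmaIn (fun t => X t ω) i) ω)) ∂P =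
      ENNReal.ofReal (branchMean^[i] F ⟨{r}, ∅⟩) := by
  have hfin : ∀ᵐ ω ∂P, sigmaIn (fun t => X t ω) i < ⊤ := by
    filter_upwards [ae_coverTime_lt_top hX] with ω hω
    exact (sigmaIn_le_coverTime _ i).trans_lt hω
  have key := hX.lintegral_stopped (I := fun _ => True) (by simp) (τ := fun x => sigmaIn x i)
    (dependsOn_sigmaIn_le i) hfin (g := fun t x => ENNReal.ofReal (pathValue F i t x))
    (fun t x y h => by simp only [dependsOn_pathValue F i t h])
    (fun t x => ENNReal.ofReal_le_one.2 (pathValue_mem hF _ _ _).2) ?_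
  · have h0 : pathValue F i 0 (fun _ => r) = branchMean^[i] F ⟨{r}, ∅⟩ := by
      -- In a tree with one vertex the starting position is trivially uniform.
      have := sum_restValue F i (T := ⟨{r}, ∅⟩) ⟨r, by simp⟩
      rw [pathValue, if_neg (by simp [Fresh]), tree_zero]
      simpa [branchCount] using this
    rw [← h0, ← key]
    refine lintegral_congr_ae ?_
    filter_upwards [hfin] with ω hω
    obtain ⟨t, ht⟩ : ∃ t : ℕ, sigmaIn (fun t => X t ω) i = t :=
      ⟨_, (WithTop.coe_untop _ hω.ne).symm⟩
    simp only [stoppedValue, ht]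
    congr 1
    exact (pathValue_of_sigmaIn_eq F ht).symm
  · intro t x _ ht
    rw [← not_le, sigmaIn_le_iff, not_or, coverTime_le_iff] at ht
    exact tsum_step_pathValue hF (not_le.1 ht.2) fun h => ht.1 ⟨t, le_rfl, h⟩

end AldousBroder

end

/-! ### Laws on countable spaces and the conclusion. -/

instance (V : Type*) : MeasurableSingletonClass (PartialTree V) := ⟨fun _ => trivial⟩

theorem PartialTree.countable (V : Type*) [Countable V] : Countable (PartialTree V) := by
  have : Function.Injective fun T : PartialTree V => (T.verts, T.edges) := by
    rintro ⟨a, b⟩ ⟨a', b'⟩ h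
    simpa using h
  exact this.countable

/-- On a countable discrete space, a law is determined by the expectations of functions with values
in `[0, 1]`. -/
theorem identDistrib_of_lintegral_eq {Ω Ω' β : Type*} [MeasurableSpace Ω] [MeasurableSpace Ω']
    [MeasurableSpace β] [Countable β] [MeasurableSingletonClass β] {Q : Measure Ω} {P : Measure Ω'}
    {f : Ω → β} {g : Ω' → β} (hf : Measurable f) (hg : Measurable g)
    (h : ∀ F : β → ℝ, (∀ b, F b ∈ Set.Icc 0 1) →
      ∫⁻ ω, ENNReal.ofReal (F (f ω)) ∂Q = ∫⁻ ω, ENNReal.ofReal (F (g ω)) ∂P) :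
    IdentDistrib f g Q P := by
  classical
  refine ⟨hf.aemeasurable, hg.aemeasurable, Measure.ext_of_singleton fun b => ?_⟩
  have hb := measurableSet_singleton b
  have key : ∀ c, ENNReal.ofReal (if c = b then 1 else 0) = Set.indicator {b} 1 c := by
    intro c
    by_cases hc : c = b <;> simp [hc]
  have h1 := h (fun c => if c = b then 1 else 0) fun c => by split_ifs <;> simp
  simp only [key] at h1
  rw [← lintegral_map (f := Set.indicator {b} 1) (measurable_one.indicator hb) hf,
    ← lintegral_map (f := Set.indicator {b} 1) (measurable_one.indicator hb) hg,
    lintegral_indicator_one hb, lintegral_indicator_one hb] at h1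
  exact h1

theorem mainTheorem1 {V : Type*} [Fintype V] [DecidableEq V] (r : V)
    {Ω : Type*} [MeasurableSpace Ω] (P : Measure Ω) [IsProbabilityMeasure P]
    {Ω' : Type*} [MeasurableSpace Ω'] (Q : Measure Ω') [IsProbabilityMeasure Q]
    (X : ℕ → Ω → V) (hX : IsMarkovChain P (LoopGraph.complete V).step r X)
    (W : ℕ → Ω' → Wilson.State V)
    (hW : IsMarkovChain Q (Wilson.step (LoopGraph.complete V)) (Wilson.init r) W) :
    (∀ i, IsStoppingTime (pastFiltration W hW.measurable)
        (fun ω => Wilson.sigmaHat (fun t => W t ω) i)) ∧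
    (∀ i, IsStoppingTime (pastFiltration X hX.measurable)
        (fun ω => AldousBroder.sigmaIn (fun t => X t ω) i)) ∧
    (∀ i, ∀ᵐ ω ∂Q, Wilson.sigmaHat (fun t => W t ω) i < ⊤) ∧
    (∀ i, ∀ᵐ ω ∂P, AldousBroder.sigmaIn (fun t => X t ω) i < ⊤) ∧
    ∀ i, IdentDistrib
      (stoppedValue (fun t ω => (W t ω).tree) (fun ω => Wilson.sigmaHat (fun t => W t ω) i))
      (stoppedValue (fun t ω => AldousBroder.tree (fun k => X k ω) t)
        (fun ω => AldousBroder.sigmaIn (fun t => X t ω) i))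
      Q P := by
  have := PartialTree.countable V
  refine ⟨fun i => isStoppingTime_of_dependsOn hW.measurable (Wilson.dependsOn_sigmaHat_le i),
    fun i => isStoppingTime_of_dependsOn hX.measurable (AldousBroder.dependsOn_sigmaIn_le i),
    fun i => ?_, fun i => ?_, fun i => ?_⟩
  · filter_upwards [Wilson.ae_endTime_lt_top hW] with ω hω
    exact (Wilson.sigmaHat_le_endTime _ i).trans_lt hω
  · filter_upwards [AldousBroder.ae_coverTime_lt_top hX] with ω hω
    exact (AldousBroder.sigmaIn_le_coverTime _ i).trans_lt hω
  · refine identDistrib_of_lintegral_eq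
      (measurable_stoppedValue_of_dependsOn hW.measurable (Wilson.dependsOn_sigmaHat_le i)
        (f := fun t w => (w t).tree) fun t x y h => by simp only [h t (by simp)])
      (measurable_stoppedValue_of_dependsOn hX.measurable (AldousBroder.dependsOn_sigmaIn_le i)
        AldousBroder.dependsOn_tree) fun F hF => ?_
    rw [Wilson.lintegral_stopped_tree hW hF, AldousBroder.lintegral_stopped_tree hX hF]
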